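/- **Setting.** Let $\mathbb K$ be a field, $d\ge 0$ an integer, $\mathcal A$ a $\mathbb K$-algebra isomorphic to $\mathrm{Mat}_{d+1}(\mathbb K)$ (rows and columns indexed by $0,\dots,d$), and $V$ a simple left $\mathcal A$-module. A *Leonard system* in $\mathcal A$ is a sequence $\Phi=(A;\{E_i\}_{i=0}^d;A^*;\{E^*_i\}_{i=0}^d)$ where $A,A^*\in\mathcal A$ each have $d+1$ mutually distinct eigenvalues in $\mathbb K$, $\{E_i\}$ (resp. $\{E_i^*\}$) is an ordering of the primitive idempotents of $A$ (resp. $A^*$), and each of $E_iA^*E_j$, $E^*_iAE^*_j$ is zero if $|i-j|>1$ and nonzero if $|i-j|=1$. Let $\theta_i$ (resp. $\theta_i^*$) be the eigenvalue of $A$ (resp. $A^*$) for $E_i$ (resp. $E_i^*$), so $E_i=\prod_{j\ne i}\frac{A-\theta_jI}{\theta_i-\theta_j}$ and similarly for $E^*_i$. Put $\tau_i=\prod_{h=0}^{i-1}(\lambda-\theta_h)$, $\eta_i=\prod_{h=0}^{i-1}(\lambda-\theta_{d-h})$, and define $\tau^*_i,\eta^*_i$ in the same way from the $\theta^*_h$.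 For $1\le i\le d$ put $$\varphi_i=(\theta_0^*-\theta_i^*)\frac{\mathrm{tr}(\tau_i(A)E_0^*)}{\mathrm{tr}(\tau_{i-1}(A)E_0^*)},\qquad \phi_i=(\theta_0^*-\theta_i^*)\frac{\mathrm{tr}(\eta_i(A)E_0^*)}{\mathrm{tr}(\eta_{i-1}(A)E_0^*)}$$ (the first and second split sequences), and let $$S=\sum_{r=0}^d\frac{\phi_d\phi_{d-1}\cdots\phi_{d-r+1}}{\varphi_1\varphi_2\cdots\varphi_r}E_r$$ be the *switching element* of $\Phi$. A *base* of $\Phi$ is a nonzero $q$ in the algebraic closure of $\mathbb K$ such that, for $2\le i\le d-1$, both $\frac{\theta_{i-2}-\theta_{i+1}}{\theta_{i-1}-\theta_i}$ and $\frac{\theta^*_{i-2}-\theta^*_{i+1}}{\theta^*_{i-1}-\theta^*_i}$ equal $q+q^{-1}+1$ (any $q\neq0$ if $d<3$). For integers $r,s,t\ge 0$ with $r+s+t\le d$ let $$[r,s,t]_q=\frac{f(r+s)f(r+t)f(s+t)}{f(r)f(s)f(t)f(r+s+t)},$$ where $f(n)=(1-q)(1-q^2)\cdots(1-q^n)$ if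 $q\neq\pm1$; $f(n)=n!$ if $q=1$ and $\mathrm{char}\,\mathbb K\ne2$; $f(n)=\lfloor n/2\rfloor!$ if $q=-1$, $\mathrm{char}\,\mathbb K\neq 2$ and $r,s,t$ are not all odd; while $[r,s,t]_q=0$ if $q=-1$, $\mathrm{char}\,\mathbb K\ne2$ and $r,s,t$ are all odd. If $q=1$ and $\mathrm{char}\,\mathbb K=2$, then $[r,s,t]_q=0$ if $r=s=t=1$ and $[r,s,t]_q=1$ otherwise. **Theorem.** (1) Let $\Phi$ be a Leonard system in $\mathcal A$ and let $0\ne v_0^*\in E_0^*V$. Then $S$ is invertible, the vectors $\tau_i(A)v_0^*$ $(0\le i\le d)$ form a basis of $V$, and $\Phi$ has a base. Let $q$ be any base of $\Phi$. For $X\in\mathcal A$ let $X^\natural$ be the matrix with $X\,\tau_j(A)v_0^*=\sum_i X^\natural_{ij}\,\tau_i(A)v_0^*$. Then $S^\natural$ and $(S^{-1})^\natural$ are lower triangular, and for $0\le j\le i\le d$ $$S^\natural_{ij}=\frac{[j,i-j,d-i]_q\,\phi_d\phi_{d-1}\cdots\phi_{d-j+1}\,\tau^*_{i-j}(\theta^*_d)}{\varphi_1\varphi_2\cdots\varphi_i},\qquad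 (S^{-1})^\natural_{ij}=\frac{[j,i-j,d-i]_q\,\varphi_1\varphi_2\cdots\varphi_j\,\eta^*_{i-j}(\theta^*_0)}{\phi_d\phi_{d-1}\cdots\phi_{d-i+1}}.$$ (2) Let $A\in\mathrm{Mat}_{d+1}(\mathbb K)$ be lower bidiagonal with diagonal $\theta_0,\dots,\theta_d$ and all subdiagonal entries $1$, and let $A^*$ be upper bidiagonal with diagonal $\theta^*_0,\dots,\theta^*_d$ and superdiagonal $\varphi_1,\dots,\varphi_d$, where the $\theta_i$ are mutually distinct, the $\theta^*_i$ are mutually distinct, and every $\varphi_i\ne0$. Let $E_i$ (resp. $E_i^*$) be the primitive idempotent of $A$ (resp. $A^*$) for $\theta_i$ (resp. $\theta^*_i$), and $\Phi=(A;\{E_i\};A^*;\{E_i^*\})$. Then $A,A^*$ is a Leonard pair on $\mathbb K^{d+1}$ (that is, there is a basis in which $A$ is irreducible tridiagonal and $A^*$ is diagonal, and a basis in which $A^*$ is irreducible tridiagonal and $A$ is diagonal) if and only if $\Phi$ is a Leonard system. In that case $\{\varphi_i\}_{i=1}^d$ is the first split sequence of $\Phi$, the switching element $S$ of $\Phi$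 is invertible, $\Phi$ has a base, and for every base $q$ the matrices $S$ and $S^{-1}$ are lower triangular, their $(i,j)$ entries for $0\le j\le i\le d$ being given by the two formulas of (1), with $\{\phi_i\}_{i=1}^d$ the second split sequence of $\Phi$. -/

import Mathlib

namespace Leonard

noncomputable section

open Polynomial

/-- `M` is irreducible tridiagonal. -/
def IsIrredTridiagonal {K : Type*} [Field K] {n : ℕ} (M : Matrix (Fin n) (Fin n) K) : Prop :=
  (∀ i j : Fin n, (i.val + 1 < j.val ∨ j.val + 1 < i.val) → M i j = 0) ∧
  (∀ i j : Fin n, (i.val + 1 = j.val ∨ j.val + 1 = i.val) → M i j ≠ 0)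

/-- `A, As` is a Leonard pair on `V`, where `V` has dimension `d + 1`. -/
def IsLeonardPair {K V : Type*} [Field K] [AddCommGroup V] [Module K V] (d : ℕ)
    (A As : Module.End K V) : Prop :=
  (∃ b : Module.Basis (Fin (d + 1)) K V,
    IsIrredTridiagonal (LinearMap.toMatrix b b A) ∧ (LinearMap.toMatrix b b As).IsDiag) ∧
  (∃ b : Module.Basis (Fin (d + 1)) K V,
    IsIrredTridiagonal (LinearMap.toMatrix b b As) ∧ (LinearMap.toMatrix b b A).IsDiag)

/-- `A` is multiplicity-free and `θ 0, …, θ d` is an ordering of its eigenvalues: they are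
mutually distinct and are exactly the elements of the spectrum. Values `θ i` with `i > d`
play no role. -/
def IsEigenvalueOrdering {K 𝒜 : Type*} [Field K] [Ring 𝒜] [Algebra K 𝒜] (d : ℕ)
    (A : 𝒜) (θ : ℕ → K) : Prop :=
  Set.InjOn θ (Set.Iic d) ∧ spectrum K A = θ '' Set.Iic d

/-- The primitive idempotent `E_i = ∏_{0 ≤ j ≤ d, j ≠ i} (A - θ_j I) / (θ_i - θ_j)` of `A`
associated with the eigenvalue `θ_i`. -/
def primitiveIdempotent {K 𝒜 : Type*} [Field K] [Ring 𝒜] [Algebra K 𝒜] (d : ℕ)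
    (A : 𝒜) (θ : ℕ → K) (i : ℕ) : 𝒜 :=
  aeval A (∏ j ∈ (Finset.range (d + 1)).erase i, (C (θ i - θ j)⁻¹ * (X - C (θ j))))

/-- The data `(A; {E_i}; A^*; {E^*_i})` of a candidate Leonard system. Orderings of the
primitive idempotents are the same thing as orderings of the eigenvalues, so the latter are
recorded and the idempotents `E_i`, `E^*_i` are obtained from them. -/
structure SystemData (K 𝒜 : Type*) where
  /-- the element `A` -/
  A : 𝒜
  /-- the element `A^*` -/
  As : 𝒜
  /-- the eigenvalue sequence; only the indices `0, …, d` matter -/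
  θ : ℕ → K
  /-- the dual eigenvalue sequence; only the indices `0, …, d` matter -/
  θs : ℕ → K

/-- `τ_i = (λ - θ_0)(λ - θ_1) ⋯ (λ - θ_{i-1})`; applied to `θ^*` it is `τ^*_i`. -/
def tau {K : Type*} [Field K] (θ : ℕ → K) (i : ℕ) : K[X] :=
  ∏ h ∈ Finset.range i, (X - C (θ h))

/-- `η_i = (λ - θ_d)(λ - θ_{d-1}) ⋯ (λ - θ_{d-i+1})`; applied to `θ^*` it is `η^*_i`. -/
def eta {K : Type*} [Field K] (d : ℕ) (θ : ℕ → K) (i : ℕ) : K[X] :=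
  ∏ h ∈ Finset.range i, (X - C (θ (d - h)))

/-- `f_1 f_2 ⋯ f_i`. -/
def prodUp {K : Type*} [Field K] (f : ℕ → K) (i : ℕ) : K :=
  ∏ h ∈ Finset.range i, f (h + 1)

/-- `f_d f_{d-1} ⋯ f_{d-i+1}`. -/
def prodDown {K : Type*} [Field K] (d : ℕ) (f : ℕ → K) (i : ℕ) : K :=
  ∏ h ∈ Finset.range i, f (d - h)

namespace SystemData

variable {K 𝒜 : Type*} [Field K] [Ring 𝒜] [Algebra K 𝒜]

/-- `E_i` -/
def E (Φ : SystemData K 𝒜) (d i : ℕ) : 𝒜 := primitiveIdempotent d Φ.A Φ.θ i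

/-- `E^*_i` -/
def Es (Φ : SystemData K 𝒜) (d i : ℕ) : 𝒜 := primitiveIdempotent d Φ.As Φ.θs i

/-- `(A; {E_i}; A^*; {E^*_i})` is a Leonard system in `𝒜`
(where `𝒜` is isomorphic to the algebra of `d + 1` by `d + 1` matrices). -/
structure IsLeonardSystem (Φ : SystemData K 𝒜) (d : ℕ) : Prop where
  ordering : IsEigenvalueOrdering d Φ.A Φ.θ
  ordering_dual : IsEigenvalueOrdering d Φ.As Φ.θs
  dual_zero : ∀ i j : ℕ, i ≤ d → j ≤ d → (i + 1 < j ∨ j + 1 < i) →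
    Φ.E d i * Φ.As * Φ.E d j = 0
  dual_ne_zero : ∀ i j : ℕ, i ≤ d → j ≤ d → (i + 1 = j ∨ j + 1 = i) →
    Φ.E d i * Φ.As * Φ.E d j ≠ 0
  zero : ∀ i j : ℕ, i ≤ d → j ≤ d → (i + 1 < j ∨ j + 1 < i) →
    Φ.Es d i * Φ.A * Φ.Es d j = 0
  ne_zero : ∀ i j : ℕ, i ≤ d → j ≤ d → (i + 1 = j ∨ j + 1 = i) →
    Φ.Es d i * Φ.A * Φ.Es d j ≠ 0

/-- The first split sequence
`φ_i = (θ^*_0 - θ^*_i) tr(τ_i(A) E^*_0) / tr(τ_{i-1}(A) E^*_0)`, `1 ≤ i ≤ d`.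
The trace on `𝒜` is the matrix trace, read through an isomorphism `e` with the matrix
algebra (it does not depend on `e`). -/
def firstSplit (Φ : SystemData K 𝒜) (d : ℕ)
    (e : 𝒜 ≃ₐ[K] Matrix (Fin (d + 1)) (Fin (d + 1)) K) (i : ℕ) : K :=
  (Φ.θs 0 - Φ.θs i) *
    ((e (aeval Φ.A (tau Φ.θ i) * Φ.Es d 0)).trace /
      (e (aeval Φ.A (tau Φ.θ (i - 1)) * Φ.Es d 0)).trace)

/-- The second split sequence
`ϕ_i = (θ^*_0 - θ^*_i) tr(η_i(A) E^*_0) / tr(η_{i-1}(A) E^*_0)`, `1 ≤ i ≤ d`. -/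
def secondSplit (Φ : SystemData K 𝒜) (d : ℕ)
    (e : 𝒜 ≃ₐ[K] Matrix (Fin (d + 1)) (Fin (d + 1)) K) (i : ℕ) : K :=
  (Φ.θs 0 - Φ.θs i) *
    ((e (aeval Φ.A (eta d Φ.θ i) * Φ.Es d 0)).trace /
      (e (aeval Φ.A (eta d Φ.θ (i - 1)) * Φ.Es d 0)).trace)

/-- The switching element
`S = ∑_{r=0}^d (ϕ_d ϕ_{d-1} ⋯ ϕ_{d-r+1}) / (φ_1 φ_2 ⋯ φ_r) E_r`. -/
def switching (Φ : SystemData K 𝒜) (d : ℕ)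
    (e : 𝒜 ≃ₐ[K] Matrix (Fin (d + 1)) (Fin (d + 1)) K) : 𝒜 :=
  ∑ r ∈ Finset.range (d + 1),
    (prodDown d (Φ.secondSplit d e) r / prodUp (Φ.firstSplit d e) r) • Φ.E d r

/-- `q` is a nonzero element of the algebraic closure such that `q + q⁻¹ + 1` is the common
value of `(θ_{i-2} - θ_{i+1}) / (θ_{i-1} - θ_i)` and
`(θ^*_{i-2} - θ^*_{i+1}) / (θ^*_{i-1} - θ^*_i)` for `2 ≤ i ≤ d - 1`
(no condition besides `q ≠ 0` if `d < 3`). -/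
def IsBase (Φ : SystemData K 𝒜) (d : ℕ) (q : AlgebraicClosure K) : Prop :=
  q ≠ 0 ∧ ∀ i : ℕ, 2 ≤ i → i + 1 ≤ d →
    algebraMap K (AlgebraicClosure K)
      ((Φ.θ (i - 2) - Φ.θ (i + 1)) / (Φ.θ (i - 1) - Φ.θ i)) = q + q⁻¹ + 1 ∧
    algebraMap K (AlgebraicClosure K)
      ((Φ.θs (i - 2) - Φ.θs (i + 1)) / (Φ.θs (i - 1) - Φ.θs i)) = q + q⁻¹ + 1

end SystemData

/-- `(q;q)_n = (1 - q)(1 - q^2) ⋯ (1 - q^n)`. -/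
def qPoch {F : Type*} [Field F] (q : F) (n : ℕ) : F :=
  ∏ k ∈ Finset.range n, (1 - q ^ (k + 1))

/-- `f(r+s) f(r+t) f(s+t) / (f(r) f(s) f(t) f(r+s+t))`. -/
def tripleRatio {F : Type*} [Field F] (f : ℕ → F) (r s t : ℕ) : F :=
  (f (r + s) * f (r + t) * f (s + t)) / (f r * f s * f t * f (r + s + t))

open Classical in
/-- The scalar `[r,s,t]_q`. For `q ≠ ±1` it is given by `q`-shifted factorials; for `q = 1`
and `q = -1` by the corresponding limits (`q = 1` in characteristic two can only be a base
with `r + s + t ≤ 3`). -/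
def bracket {F : Type*} [Field F] (q : F) (r s t : ℕ) : F :=
  if q = 1 then
    if (2 : F) = 0 then
      (if r = 1 ∧ s = 1 ∧ t = 1 then 0 else 1)
    else tripleRatio (fun n => ((Nat.factorial n : ℕ) : F)) r s t
  else if q = -1 then
    if Odd r ∧ Odd s ∧ Odd t then 0
    else tripleRatio (fun n => ((Nat.factorial (n / 2) : ℕ) : F)) r s t
  else tripleRatio (qPoch q) r s t

/-- The matrix `Y` that represents `X ∈ 𝒜` with respect to a basis `b` of the `𝒜`-module
`V`: `X b_j = ∑_i Y_{ij} b_i`. -/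
def repMatrix {K 𝒜 V ι : Type*} [Field K] [Ring 𝒜] [AddCommGroup V] [Module K V]
    [Module 𝒜 V] (b : Module.Basis ι K V) (X : 𝒜) : Matrix ι ι K :=
  Matrix.of fun i j => b.repr (X • b j) i

/-- `M` is lower triangular and, for `0 ≤ j ≤ i ≤ d`, its `(i,j)` entry is
`[j,i-j,d-i]_q ϕ_d ⋯ ϕ_{d-j+1} τ^*_{i-j}(θ^*_d) / (φ_1 ⋯ φ_i)`. -/
def HasSwitchingEntries {K : Type*} [Field K] (d : ℕ) (θs φ ϕ : ℕ → K)
    (q : AlgebraicClosure K) (M : Matrix (Fin (d + 1)) (Fin (d + 1)) K) : Prop :=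
  (∀ i j : Fin (d + 1), i < j → M i j = 0) ∧
  ∀ i j : Fin (d + 1), j ≤ i →
    algebraMap K (AlgebraicClosure K) (M i j) =
      bracket q j.val (i.val - j.val) (d - i.val) *
        algebraMap K (AlgebraicClosure K)
          (prodDown d ϕ j.val * (tau θs (i.val - j.val)).eval (θs d) / prodUp φ i.val)

/-- `M` is lower triangular and, for `0 ≤ j ≤ i ≤ d`, its `(i,j)` entry is
`[j,i-j,d-i]_q φ_1 ⋯ φ_j η^*_{i-j}(θ^*_0) / (ϕ_d ⋯ ϕ_{d-i+1})`. -/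
def HasInverseSwitchingEntries {K : Type*} [Field K] (d : ℕ) (θs φ ϕ : ℕ → K)
    (q : AlgebraicClosure K) (M : Matrix (Fin (d + 1)) (Fin (d + 1)) K) : Prop :=
  (∀ i j : Fin (d + 1), i < j → M i j = 0) ∧
  ∀ i j : Fin (d + 1), j ≤ i →
    algebraMap K (AlgebraicClosure K) (M i j) =
      bracket q j.val (i.val - j.val) (d - i.val) *
        algebraMap K (AlgebraicClosure K)
          (prodUp φ j.val * (eta d θs (i.val - j.val)).eval (θs 0) / prodDown d ϕ i.val)

/-- The lower bidiagonal matrix with diagonal `θ_0, …, θ_d` and ones below the diagonal. -/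
def lowerBidiagonal {K : Type*} [Field K] (d : ℕ) (θ : ℕ → K) :
    Matrix (Fin (d + 1)) (Fin (d + 1)) K :=
  Matrix.of fun i j => if i = j then θ i.val else if i.val = j.val + 1 then 1 else 0

/-- The upper bidiagonal matrix with diagonal `θ^*_0, …, θ^*_d` and superdiagonal
`φ_1, …, φ_d` (the `(i-1,i)` entry is `φ_i`). -/
def upperBidiagonal {K : Type*} [Field K] (d : ℕ) (θs φ : ℕ → K) :
    Matrix (Fin (d + 1)) (Fin (d + 1)) K :=
  Matrix.of fun i j => if i = j then θs i.val else if j.val = i.val + 1 then φ j.val else 0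

/-- The system data `(A; {E_i}; A^*; {E^*_i})` of the pair of bidiagonal matrices. -/
def bidiagonalData {K : Type*} [Field K] (d : ℕ) (θ θs φ : ℕ → K) :
    SystemData K (Matrix (Fin (d + 1)) (Fin (d + 1)) K) where
  A := lowerBidiagonal d θ
  As := upperBidiagonal d θs φ
  θ := θ
  θs := θs

end

end Leonard

-- The proof compares two split bases. Read everything in matrices and let the columns of `P` and
-- `Q` be eigenvectors of `A` and `A^*`, so that each element is irreducible tridiagonal in the
-- eigenbasis of the other. Let `v` be the first column of `Q`. On the basis `τ_j(A) v`, with matrix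
-- `W`, the element `A` is the lower bidiagonal matrix `L` with ones below the diagonal. `A^*` is
-- upper bidiagonal with diagonal `θ^*_i` and superdiagonal `φ_i` (`IsSystem.split`,
-- `IsSystem.splitSequence_spec`). The same construction for the transposed pair with the `θ_i`
-- reversed, carried back by inverse transpose and reversal of columns, gives a second basis `H`
-- (`IsSystem.exists_reversed_split`). There `A` is again `L`, while `A^*` is upper bidiagonal with
-- diagonal `θ^*_{d-i}` and superdiagonal `ϕ_{d-i+1}`.
--
-- Let `T` be `W⁻¹ H`, scaled so that its corner entry is 1. It commutes with `L`, hence is lower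
-- triangular and determined by its diagonal, because the `θ_i` are distinct. It also intertwines
-- the two upper bidiagonal matrices, which forces the diagonal entries `ϕ_d ⋯ ϕ_{d-i+1} / (φ_1 ⋯
-- φ_i)`. In the basis `W`, the switching element is a polynomial in `L` with these same diagonal
-- entries, so it is `T` (`IsSystem.switching`).
--
-- The intertwining relation is also a row recurrence for the entries of `T`. The closed formula
-- satisfies it by a three-term identity between brackets and the `θ^*_i`
-- (`IsRecurrent.bracket_rec`, `transition_apply`). The inverse of `T` intertwines in the opposite
-- direction, so the same computation with the two sets of data exchanged gives its entries.
--
-- A base exists because some polynomial `p` satisfies `A²A^*A - AA^*A² = [p(A), A^*]`. In the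
-- eigenbasis of `A^*` this bounds the degree of `p` by 3, and its cubic coefficient governs both
-- eigenvalue sequences (`IsSystem.exists_recurrence`).
--
-- For a general algebra, the rank one idempotent `E^*_0` identifies `V` with the column vectors.
-- For bidiagonal matrices `W` is scalar, so no change of basis remains. A Leonard pair gives the
-- required orderings because a permutation moving neighbours to neighbours is the identity or the
-- reversal.

namespace Leonard

open Polynomial Matrix

-- Matrices with a bounded number of superdiagonals

section Banded

variable {K : Type*} [Field K] {n : ℕ}

/-- `M` has at most `k` nonzero superdiagonals. -/
def UpperBand (k : ℕ) (M : Matrix (Fin n) (Fin n) K) : Prop :=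
  ∀ i j : Fin n, i.val + k < j.val → M i j = 0

theorem UpperBand.mul {k l : ℕ} {M N : Matrix (Fin n) (Fin n) K} (hM : UpperBand k M)
    (hN : UpperBand l N) : UpperBand (k + l) (M * N) := by
  intro i j hij
  rw [Matrix.mul_apply]
  refine Finset.sum_eq_zero fun m _ => ?_
  by_cases h : i.val + k < m.val
  · rw [hM i m h, zero_mul]
  · rw [hN m j (by omega), mul_zero]

/-- On the outermost diagonal of a product of banded matrices only one intermediate index
contributes. This is how leading entries are read off below. -/
theorem UpperBand.mul_apply {k l : ℕ} {M N : Matrix (Fin n) (Fin n) K} (hM : UpperBand k M)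
    (hN : UpperBand l N) {i m j : Fin n} (him : m.val = i.val + k) (hmj : j.val = m.val + l) :
    (M * N) i j = M i m * N m j := by
  rw [Matrix.mul_apply]
  refine Finset.sum_eq_single m (fun b _ hb => ?_) (by simp)
  have hb' : b.val ≠ m.val := fun h => hb (Fin.ext h)
  by_cases h : i.val + k < b.val
  · rw [hM i b h, zero_mul]
  · rw [hN b j (by omega), mul_zero]

theorem upperBand_diagonal (f : Fin n → K) : UpperBand 0 (diagonal f) := fun i j hij =>
  diagonal_apply_ne _ (by rintro rfl; omega)

theorem upperBand_one : UpperBand 0 (1 : Matrix (Fin n) (Fin n) K) := by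
  rw [← diagonal_one]; exact upperBand_diagonal _

theorem UpperBand.blockTriangular {M : Matrix (Fin n) (Fin n) K} (hM : UpperBand 0 M) :
    BlockTriangular M OrderDual.toDual := fun i j hij => hM i j (by simpa using hij)

theorem UpperBand.inv {M : Matrix (Fin n) (Fin n) K} (hM : UpperBand 0 M) (hu : IsUnit M) :
    UpperBand 0 M⁻¹ := by
  have := hu.invertible
  intro i j hij
  exact blockTriangular_inv_of_blockTriangular hM.blockTriangular (by simpa using hij)

theorem UpperBand.isUnit {M : Matrix (Fin n) (Fin n) K} (hM : UpperBand 0 M)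
    (h : ∀ i, M i i ≠ 0) : IsUnit M := by
  rw [Matrix.isUnit_iff_isUnit_det, det_of_isLowerTriangular M hM.blockTriangular]
  exact (Finset.prod_ne_zero_iff.2 fun i _ => h i).isUnit

theorem UpperBand.apply_self_ne_zero {M : Matrix (Fin n) (Fin n) K} (hM : UpperBand 0 M)
    (hu : IsUnit M) (i : Fin n) : M i i ≠ 0 := by
  rw [Matrix.isUnit_iff_isUnit_det, det_of_isLowerTriangular M hM.blockTriangular] at hu
  exact Finset.prod_ne_zero_iff.1 hu.ne_zero i (Finset.mem_univ i)

end Banded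

-- Bidiagonal matrices and their commutants

section Bidiagonal

variable {K : Type*} [Field K] {d : ℕ}

theorem mul_lowerBidiagonal_of_succ (W : Matrix (Fin (d + 1)) (Fin (d + 1)) K) (θ : ℕ → K)
    (i j k : Fin (d + 1)) (h : k.val = j.val + 1) :
    (W * lowerBidiagonal d θ) i j = W i j * θ j + W i k := by
  have hjk : j ≠ k := fun e => by rw [e] at h; omega
  rw [Matrix.mul_apply, Finset.sum_eq_add j k hjk]
  · simp [lowerBidiagonal, h, hjk.symm]
  · intro c _ hc
    have : c.val ≠ j.val + 1 := fun e => hc.2 (Fin.ext (e.trans h.symm))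
    simp [lowerBidiagonal, hc.1, this]
  · simp
  · simp

theorem mul_lowerBidiagonal_of_eq (W : Matrix (Fin (d + 1)) (Fin (d + 1)) K) (θ : ℕ → K)
    (i j : Fin (d + 1)) (h : j.val = d) :
    (W * lowerBidiagonal d θ) i j = W i j * θ j := by
  rw [Matrix.mul_apply, Finset.sum_eq_single j]
  · simp [lowerBidiagonal]
  · intro c _ hc
    have : c.val ≠ j.val + 1 := by omega
    simp [lowerBidiagonal, hc, this]
  · simp

theorem mul_upperBidiagonal_of_succ (W : Matrix (Fin (d + 1)) (Fin (d + 1)) K) (θs φ : ℕ → K)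
    (i j k : Fin (d + 1)) (h : j.val = k.val + 1) :
    (W * upperBidiagonal d θs φ) i j = W i j * θs j + W i k * φ j := by
  have hjk : j ≠ k := fun e => by rw [e] at h; omega
  rw [Matrix.mul_apply, Finset.sum_eq_add j k hjk]
  · simp [upperBidiagonal, h, hjk.symm]
  · intro c _ hc
    have : ¬ j.val = c.val + 1 := fun e => hc.2 (Fin.ext (by omega))
    simp [upperBidiagonal, hc.1, this]
  · simp
  · simp

theorem mul_upperBidiagonal_of_eq_zero (W : Matrix (Fin (d + 1)) (Fin (d + 1)) K)
    (θs φ : ℕ → K) (i j : Fin (d + 1)) (h : j.val = 0) :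
    (W * upperBidiagonal d θs φ) i j = W i j * θs j := by
  rw [Matrix.mul_apply, Finset.sum_eq_single j]
  · simp [upperBidiagonal]
  · intro c _ hc
    have : ¬ j.val = c.val + 1 := by omega
    simp [upperBidiagonal, hc, this]
  · simp

theorem transpose_lowerBidiagonal (θ : ℕ → K) :
    (lowerBidiagonal d θ)ᵀ = upperBidiagonal d θ 1 := by
  ext i j
  by_cases h : i = j
  · subst h; simp [lowerBidiagonal, upperBidiagonal]
  · simp [lowerBidiagonal, upperBidiagonal, h, Ne.symm h]

theorem lowerBidiagonal_mul_of_succ (W : Matrix (Fin (d + 1)) (Fin (d + 1)) K) (θ : ℕ → K)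
    (i j k : Fin (d + 1)) (h : i.val = k.val + 1) :
    (lowerBidiagonal d θ * W) i j = θ i * W i j + W k j := by
  have := mul_upperBidiagonal_of_succ Wᵀ θ 1 j i k h
  rw [← transpose_lowerBidiagonal, ← transpose_mul] at this
  simpa [mul_comm] using this

theorem lowerBidiagonal_mul_of_eq_zero (W : Matrix (Fin (d + 1)) (Fin (d + 1)) K) (θ : ℕ → K)
    (i j : Fin (d + 1)) (h : i.val = 0) :
    (lowerBidiagonal d θ * W) i j = θ i * W i j := by
  have := mul_upperBidiagonal_of_eq_zero Wᵀ θ 1 j i h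
  rw [← transpose_lowerBidiagonal, ← transpose_mul] at this
  simpa [mul_comm] using this

theorem upperBidiagonal_mul_of_succ (W : Matrix (Fin (d + 1)) (Fin (d + 1)) K) (θs φ : ℕ → K)
    (i j k : Fin (d + 1)) (h : k.val = i.val + 1) :
    (upperBidiagonal d θs φ * W) i j = θs i * W i j + φ k * W k j := by
  have hjk : i ≠ k := fun e => by rw [e] at h; omega
  rw [Matrix.mul_apply, Finset.sum_eq_add i k hjk]
  · simp [upperBidiagonal, h, hjk]
  · intro c _ hc
    have : ¬ c.val = i.val + 1 := fun e => hc.2 (Fin.ext (e.trans h.symm))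
    simp [upperBidiagonal, hc.1.symm, this]
  · simp
  · simp

theorem upperBand_lowerBidiagonal (θ : ℕ → K) : UpperBand 0 (lowerBidiagonal d θ) := by
  intro i j h
  have h1 : i ≠ j := by rintro rfl; omega
  have h2 : ¬ i.val = j.val + 1 := by omega
  simp [lowerBidiagonal, h1, h2]

/-- The entries of a matrix commuting with a lower bidiagonal matrix are determined by those
on the diagonal. -/
theorem eq_zero_of_commute_lowerBidiagonal {θ : ℕ → K} (hθ : Set.InjOn θ (Set.Iic d))
    {N : Matrix (Fin (d + 1)) (Fin (d + 1)) K}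
    (hN : lowerBidiagonal d θ * N = N * lowerBidiagonal d θ) (m : ℕ)
    (hdiag : ∀ i : Fin (d + 1), d + 1 ≤ m → N i i = 0) :
    ∀ k ≤ m, ∀ i j : Fin (d + 1), i.val + (d + 1) = j.val + k → N i j = 0 := by
  -- The induction runs over diagonals starting from the top right corner: `k` labels the diagonal
  -- `j - i = d + 1 - k`, so `k = d + 1` is the main one, the only place where `hdiag` is needed.
  intro k
  induction k with
  | zero => intro _ i j h; omega
  | succ k ih =>
    intro hk i j h
    by_cases hij : i = j
    · subst hij; exact hdiag i (by omega)
    have hne : θ i - θ j ≠ 0 := sub_ne_zero.2 fun e => hij (Fin.ext (hθ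
      (Set.mem_Iic.2 (by omega)) (Set.mem_Iic.2 (by omega)) e))
    have key : (lowerBidiagonal d θ * N) i j = θ i * N i j := by
      by_cases hi : i.val = 0
      · exact lowerBidiagonal_mul_of_eq_zero N θ i j hi
      · rw [lowerBidiagonal_mul_of_succ N θ i j ⟨i.val - 1, by omega⟩ (by simp; omega),
          ih (by omega) ⟨i.val - 1, by omega⟩ j (by simp; omega), add_zero]
    have key' : (N * lowerBidiagonal d θ) i j = N i j * θ j := by
      by_cases hj : j.val = d
      · exact mul_lowerBidiagonal_of_eq N θ i j hj
      · rw [mul_lowerBidiagonal_of_succ N θ i j ⟨j.val + 1, by omega⟩ rfl,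
          ih (by omega) i ⟨j.val + 1, by omega⟩ (by simp; omega), add_zero]
    rw [hN, key'] at key
    have : (θ i - θ j) * N i j = 0 := by linear_combination -key
    exact (mul_eq_zero.1 this).resolve_left hne

theorem upperBand_of_commute_lowerBidiagonal {θ : ℕ → K} (hθ : Set.InjOn θ (Set.Iic d))
    {N : Matrix (Fin (d + 1)) (Fin (d + 1)) K}
    (hN : lowerBidiagonal d θ * N = N * lowerBidiagonal d θ) : UpperBand 0 N := fun i j h =>
  eq_zero_of_commute_lowerBidiagonal hθ hN d (fun _ h => by omega) (i.val + (d + 1) - j.val)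
    (by omega) i j (by omega)

theorem ext_of_commute_lowerBidiagonal {θ : ℕ → K} (hθ : Set.InjOn θ (Set.Iic d))
    {M N : Matrix (Fin (d + 1)) (Fin (d + 1)) K}
    (hM : lowerBidiagonal d θ * M = M * lowerBidiagonal d θ)
    (hN : lowerBidiagonal d θ * N = N * lowerBidiagonal d θ) (h : ∀ i, M i i = N i i) :
    M = N := by
  rw [← sub_eq_zero]
  ext i j
  exact eq_zero_of_commute_lowerBidiagonal hθ (N := M - N) (by rw [mul_sub, sub_mul, hM, hN])
    (i.val + (d + 1)) (fun i _ => by simp [h i]) (i.val + (d + 1) - j.val) (by omega) i j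
    (by omega)

end Bidiagonal

theorem injOn_reverse {α : Type*} {d : ℕ} {θ : ℕ → α} (h : Set.InjOn θ (Set.Iic d)) :
    Set.InjOn (fun i => θ (d - i)) (Set.Iic d) := by
  intro i hi j hj hij
  rw [Set.mem_Iic] at hi hj
  have := h (Set.mem_Iic.2 (Nat.sub_le d i)) (Set.mem_Iic.2 (Nat.sub_le d j)) hij
  omega

-- Leonard systems described by eigenbases, with transposition and reversal

section Diagonalization

variable {K : Type*} [Field K] {d : ℕ}

/-- The columns of `P` are eigenvectors of `A`, with eigenvalues `θ 0, …, θ d`, and `B` acts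
on them in an irreducible tridiagonal fashion. -/
structure IsTridiagonalizedBy (A B P : Matrix (Fin (d + 1)) (Fin (d + 1)) K) (θ : ℕ → K) :
    Prop where
  isUnit : IsUnit P
  mul_eq : A * P = P * diagonal fun i : Fin (d + 1) => θ i
  tridiagonal : IsIrredTridiagonal (P⁻¹ * B * P)

theorem IsIrredTridiagonal.upperBand {n : ℕ} {M : Matrix (Fin n) (Fin n) K}
    (h : IsIrredTridiagonal M) : UpperBand 1 M := fun i j hij => h.1 i j (Or.inl hij)

theorem IsIrredTridiagonal.transpose {n : ℕ} {M : Matrix (Fin n) (Fin n) K}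
    (h : IsIrredTridiagonal M) : IsIrredTridiagonal Mᵀ :=
  ⟨fun i j hij => h.1 j i hij.symm, fun i j hij => h.2 j i hij.symm⟩

/-- A system of matrices given by eigenbases. -/
structure IsSystem (A B : Matrix (Fin (d + 1)) (Fin (d + 1)) K) (θ θs : ℕ → K)
    (P Q : Matrix (Fin (d + 1)) (Fin (d + 1)) K) : Prop where
  injOn : Set.InjOn θ (Set.Iic d)
  injOn_dual : Set.InjOn θs (Set.Iic d)
  left : IsTridiagonalizedBy A B P θ
  right : IsTridiagonalizedBy B A Q θs

variable {A B P Q : Matrix (Fin (d + 1)) (Fin (d + 1)) K} {θ θs : ℕ → K}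

theorem inv_mul_eq_of_mul_eq {n : Type*} [Fintype n] [DecidableEq n] {A P M : Matrix n n K}
    (hP : IsUnit P) (h : A * P = P * M) : P⁻¹ * A = M * P⁻¹ := by
  rw [Matrix.isUnit_iff_isUnit_det] at hP
  rw [← Matrix.mul_nonsing_inv_cancel_right P (P⁻¹ * A) hP, Matrix.mul_assoc P⁻¹, h,
    Matrix.nonsing_inv_mul_cancel_left P _ hP]

/-- The rows of `P⁻¹` are left eigenvectors, and the tridiagonal shape is symmetric. -/
theorem IsTridiagonalizedBy.transpose (h : IsTridiagonalizedBy A B P θ) :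
    IsTridiagonalizedBy Aᵀ Bᵀ P⁻¹ᵀ θ := by
  have hP := (Matrix.isUnit_iff_isUnit_det P).1 h.isUnit
  refine ⟨?_, ?_, ?_⟩
  · rw [Matrix.isUnit_iff_isUnit_det, det_transpose]
    exact P.isUnit_nonsing_inv_det hP
  · rw [← transpose_mul, inv_mul_eq_of_mul_eq h.isUnit h.mul_eq, transpose_mul,
      diagonal_transpose]
  · have : P⁻¹ᵀ⁻¹ * Bᵀ * P⁻¹ᵀ = (P⁻¹ * B * P)ᵀ := by
      rw [← transpose_nonsing_inv, Matrix.nonsing_inv_nonsing_inv P hP]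
      simp only [transpose_mul, Matrix.mul_assoc]
    rw [this]
    exact h.tridiagonal.transpose

theorem IsTridiagonalizedBy.reverse (h : IsTridiagonalizedBy A B P θ) :
    IsTridiagonalizedBy A B (P.submatrix id Fin.revPerm) (fun i => θ (d - i)) := by
  have hinv : (P.submatrix id Fin.revPerm)⁻¹ = P⁻¹.submatrix Fin.revPerm id := by
    have := Matrix.inv_submatrix_equiv P (Equiv.refl _) Fin.revPerm
    simpa using this
  refine ⟨?_, ?_, ?_⟩
  · exact (Matrix.isUnit_submatrix_equiv (Equiv.refl _) Fin.revPerm).2 h.isUnit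
  · ext i j
    have := congrFun (congrFun h.mul_eq i) (Fin.rev j)
    rw [mul_diagonal] at this ⊢
    simpa [Matrix.mul_apply, Fin.val_rev] using this
  · rw [hinv]
    have : P⁻¹.submatrix Fin.revPerm id * B * P.submatrix id Fin.revPerm =
        (P⁻¹ * B * P).submatrix Fin.rev Fin.rev := by
      ext i j
      simp [Matrix.mul_apply]
    rw [this]
    refine ⟨fun i j hij => h.tridiagonal.1 _ _ ?_, fun i j hij => h.tridiagonal.2 _ _ ?_⟩
    · simp only [Fin.val_rev]; omega
    · simp only [Fin.val_rev]; omega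

theorem IsSystem.transpose (h : IsSystem A B θ θs P Q) :
    IsSystem Aᵀ Bᵀ θ θs P⁻¹ᵀ Q⁻¹ᵀ :=
  ⟨h.injOn, h.injOn_dual, h.left.transpose, h.right.transpose⟩

theorem IsSystem.reverse (h : IsSystem A B θ θs P Q) :
    IsSystem A B (fun i => θ (d - i)) θs (P.submatrix id Fin.revPerm) Q :=
  ⟨injOn_reverse h.injOn, h.injOn_dual, h.left.reverse, h.right⟩

end Diagonalization

-- The split form of a Leonard system

section Split

variable {K : Type*} [Field K] {d : ℕ}
  {A B P Q W : Matrix (Fin (d + 1)) (Fin (d + 1)) K} {θ θs : ℕ → K}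

theorem inv_mul_mul_cancel {n : Type*} [Fintype n] [DecidableEq n] {P M W : Matrix n n K}
    (hP : IsUnit P) : P⁻¹ * M * P * (P⁻¹ * W) = P⁻¹ * (M * W) := by
  rw [Matrix.isUnit_iff_isUnit_det] at hP
  rw [Matrix.mul_assoc _ P, Matrix.mul_nonsing_inv_cancel_left P _ hP, Matrix.mul_assoc]

/-- In the eigenbasis of `B`, the columns `W_j` have triangular coordinates. -/
theorem IsTridiagonalizedBy.split_lower (h : IsTridiagonalizedBy B A Q θs)
    (hθs : Set.InjOn θs (Set.Iic d))
    (hAW : A * W = W * lowerBidiagonal d θ) (hBW : ∀ i, (B * W) i 0 = θs 0 * W i 0)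
    (hW : ∃ i, W i 0 ≠ 0) :
    UpperBand 0 (Q⁻¹ * W)ᵀ ∧ ∀ j, (Q⁻¹ * W) j j ≠ 0 := by
  set C := Q⁻¹ * W with hC
  obtain ⟨M, hM⟩ : ∃ M, M = Q⁻¹ * A * Q := ⟨_, rfl⟩
  have hT := h.tridiagonal
  rw [← hM] at hT
  have hQ := (Matrix.isUnit_iff_isUnit_det Q).1 h.isUnit
  have hMC : M * C = C * lowerBidiagonal d θ := by
    rw [hM, hC, inv_mul_mul_cancel h.isUnit, hAW, Matrix.mul_assoc]
  have hQC : W = Q * C := by rw [hC, Matrix.mul_nonsing_inv_cancel_left Q _ hQ]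
  -- The first column of `W` is an eigenvector of `B` for `θs 0`, so only its coordinate 0 can
  -- survive.
  have hC0 : ∀ i, i ≠ 0 → C i 0 = 0 := by
    intro i hi
    have h1 : (diagonal (fun i : Fin (d + 1) => θs i) * C) i 0 = θs 0 * C i 0 := by
      rw [hC, ← Matrix.mul_assoc, ← inv_mul_eq_of_mul_eq h.isUnit h.mul_eq, Matrix.mul_assoc,
        Matrix.mul_apply, Matrix.mul_apply, Finset.mul_sum]
      exact Finset.sum_congr rfl fun k _ => by rw [hBW]; ring
    rw [diagonal_mul] at h1
    have hne : θs i - θs 0 ≠ 0 := sub_ne_zero.2 fun e => hi (Fin.ext (hθs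
      (Set.mem_Iic.2 (by omega)) (Set.mem_Iic.2 (by omega)) e))
    exact (mul_eq_zero.1 (by linear_combination h1 : (θs i - θs 0) * C i 0 = 0)).resolve_left hne
  have hC00 : C 0 0 ≠ 0 := by
    intro h0
    obtain ⟨i, hi⟩ := hW
    refine hi ?_
    rw [hQC, Matrix.mul_apply]
    refine Finset.sum_eq_zero fun k _ => ?_
    by_cases hk : k = 0
    · rw [hk, h0, mul_zero]
    · rw [hC0 k hk, mul_zero]
  have key : ∀ m : ℕ, ∀ j : Fin (d + 1), j.val = m →
      (∀ i, j < i → C i j = 0) ∧ C j j ≠ 0 := by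
    intro m
    induction m with
    | zero =>
      intro j hj
      obtain rfl : j = 0 := Fin.ext hj
      exact ⟨fun i hi => hC0 i hi.ne', hC00⟩
    | succ m ih =>
      intro k hk
      obtain ⟨ih1, ih2⟩ := ih ⟨m, by omega⟩ rfl
      set j : Fin (d + 1) := ⟨m, by omega⟩ with hj
      have hjk : k.val = j.val + 1 := hk
      -- Column `j + 1` is `A - θ_j` applied to column `j`. Below row `j` the `θ_j` term vanishes,
      -- and tridiagonality raises the last nonzero coordinate by exactly one.
      have step : ∀ i, j < i → C i k = ∑ l, M i l * C l j := by
        intro i hi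
        have := mul_lowerBidiagonal_of_succ C θ i j k hjk
        rw [ih1 i hi, zero_mul, zero_add, ← hMC, Matrix.mul_apply] at this
        exact this.symm
      constructor
      · intro i hi
        rw [step i (by rw [Fin.lt_def] at hi ⊢; omega)]
        refine Finset.sum_eq_zero fun l _ => ?_
        by_cases hl : j < l
        · rw [ih1 l hl, mul_zero]
        · rw [hT.1 i l (Or.inr ?_), zero_mul]
          rw [Fin.lt_def] at hi hl; omega
      · rw [step k (by rw [Fin.lt_def]; omega), Finset.sum_eq_single j]
        · exact mul_ne_zero (hT.2 k j (Or.inr hjk.symm)) ih2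
        · intro l _ hlj
          by_cases hl : j < l
          · rw [ih1 l hl, mul_zero]
          · rw [hT.1 k l (Or.inr ?_), zero_mul]
            have : l.val ≠ j.val := fun e => hlj (Fin.ext e)
            rw [Fin.lt_def] at hl; omega
        · simp
  exact ⟨fun i j hij => (key _ i rfl).1 j (by rw [Fin.lt_def]; omega), fun j => (key _ j rfl).2⟩

/-- In the eigenbasis of `A`, the columns `W_j` have triangular coordinates. -/
theorem IsTridiagonalizedBy.split_upper (h : IsTridiagonalizedBy A B P θ)
    (hAW : A * W = W * lowerBidiagonal d θ) : UpperBand 0 (P⁻¹ * W) := by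
  set R := P⁻¹ * W with hR
  have hDR : diagonal (fun i : Fin (d + 1) => θ i) * R = R * lowerBidiagonal d θ := by
    rw [hR, ← Matrix.mul_assoc, ← inv_mul_eq_of_mul_eq h.isUnit h.mul_eq, Matrix.mul_assoc,
      hAW, Matrix.mul_assoc]
  have key : ∀ m : ℕ, ∀ i j : Fin (d + 1), j.val = m → i < j → R i j = 0 := by
    intro m
    induction m with
    | zero => intro i j hj hi; rw [Fin.lt_def] at hi; omega
    | succ m ih =>
      intro i k hk hi
      set j : Fin (d + 1) := ⟨m, by omega⟩ with hj
      have h1 := mul_lowerBidiagonal_of_succ R θ i j k hk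
      rw [← hDR, diagonal_mul] at h1
      by_cases hij : i < j
      · rw [ih i j rfl hij] at h1
        linear_combination -h1
      -- Here the new zero appears: applying `A - θ_j` annihilates the coordinate along the
      -- eigenvector for `θ_j`.
      · have hji : i = j := by
          apply Fin.ext; rw [Fin.lt_def] at hi hij; have : j.val = m := rfl; omega
        rw [hji] at h1 ⊢
        linear_combination -h1
  exact fun i j hij => key _ i j rfl (by rw [Fin.lt_def]; omega)

/-- The split form: `B` becomes upper bidiagonal once `A` is lower bidiagonal and the first
basis vector is an eigenvector of `B` for `θs 0`. -/
theorem IsSystem.split (h : IsSystem A B θ θs P Q)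
    (hAW : A * W = W * lowerBidiagonal d θ) (hBW : ∀ i, (B * W) i 0 = θs 0 * W i 0)
    (hW : ∃ i, W i 0 ≠ 0) :
    IsUnit W ∧ ∃ φ : ℕ → K, (∀ i, 1 ≤ i → i ≤ d → φ i ≠ 0) ∧
      B * W = W * upperBidiagonal d θs φ := by
  obtain ⟨hC, hCne⟩ := h.right.split_lower h.injOn_dual hAW hBW hW
  have hQ := (Matrix.isUnit_iff_isUnit_det Q).1 h.right.isUnit
  have hP := (Matrix.isUnit_iff_isUnit_det P).1 h.left.isUnit
  have hCu : IsUnit (Q⁻¹ * W) := by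
    have := hC.isUnit hCne
    rwa [Matrix.isUnit_iff_isUnit_det, det_transpose, ← Matrix.isUnit_iff_isUnit_det] at this
  have hWu : IsUnit W := by
    have := h.right.isUnit.mul hCu
    rwa [Matrix.mul_nonsing_inv_cancel_left Q _ hQ] at this
  refine ⟨hWu, ?_⟩
  have hWd := (Matrix.isUnit_iff_isUnit_det W).1 hWu
  have hR := h.left.split_upper hAW
  have hRu : IsUnit (P⁻¹ * W) := by
    refine IsUnit.mul ?_ hWu
    rw [Matrix.isUnit_iff_isUnit_det]
    exact P.isUnit_nonsing_inv_det hP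
  have hWinv : ∀ Y : Matrix (Fin (d + 1)) (Fin (d + 1)) K, W * (W⁻¹ * Y) = Y := fun Y =>
    Matrix.mul_nonsing_inv_cancel_left W Y hWd
  set X := W⁻¹ * B * W with hX
  have hBX : B * W = W * X := by rw [hX, Matrix.mul_assoc, hWinv]
  have hRX : P⁻¹ * W * X = P⁻¹ * B * P * (P⁻¹ * W) := by
    rw [inv_mul_mul_cancel h.left.isUnit, hBX, Matrix.mul_assoc]
  have hCX : Q⁻¹ * W * X = diagonal (fun i : Fin (d + 1) => θs i) * (Q⁻¹ * W) := by
    rw [← Matrix.mul_assoc (diagonal _), ← inv_mul_eq_of_mul_eq h.right.isUnit h.right.mul_eq,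
      Matrix.mul_assoc, Matrix.mul_assoc, hBX]
  -- `X` is the matrix of `B` in the basis `W`. Passing through the eigenbasis of `A` allows at most
  -- one superdiagonal; passing through that of `B` will remove everything below the diagonal.
  have hX1 : UpperBand 1 X := by
    have : X = (P⁻¹ * W)⁻¹ * ((P⁻¹ * B * P) * (P⁻¹ * W)) := by
      rw [← hRX, Matrix.nonsing_inv_mul_cancel_left _ _
        ((Matrix.isUnit_iff_isUnit_det _).1 hRu)]
    rw [this]
    exact (hR.inv hRu).mul (h.left.tridiagonal.upperBand.mul hR)
  have hCt : Xᵀ * (Q⁻¹ * W)ᵀ = (Q⁻¹ * W)ᵀ * diagonal (fun i : Fin (d + 1) => θs i) := by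
    rw [← transpose_mul, hCX, transpose_mul, diagonal_transpose]
  have hCtu : IsUnit (Q⁻¹ * W)ᵀ := hC.isUnit hCne
  have hX0 : UpperBand 0 Xᵀ := by
    have : Xᵀ = (Q⁻¹ * W)ᵀ * diagonal (fun i : Fin (d + 1) => θs i) * ((Q⁻¹ * W)ᵀ)⁻¹ := by
      rw [← hCt, Matrix.mul_nonsing_inv_cancel_right _ _
        ((Matrix.isUnit_iff_isUnit_det _).1 hCtu)]
    rw [this]
    exact (hC.mul (upperBand_diagonal _)).mul (hC.inv hCtu)
  have hXd : ∀ i, X i i = θs i := by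
    intro i
    have h1 := hX0.mul_apply hC (i := i) (m := i) (j := i) rfl rfl
    rw [hCt, mul_diagonal, transpose_apply, transpose_apply, mul_comm] at h1
    exact (mul_right_cancel₀ (hCne i) h1).symm
  refine ⟨fun j => if hj : 1 ≤ j ∧ j ≤ d then X ⟨j - 1, by omega⟩ ⟨j, by omega⟩ else 0, ?_, ?_⟩
  · intro j hj1 hjd
    simp only [dif_pos (And.intro hj1 hjd)]
    intro h0
    -- The `(j-1, j)` entry of `R X = (P⁻¹ B P) R`, with `R = P⁻¹ W` lower triangular, has a single
    -- term on each side; the right one is nonzero by irreducibility.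
    have h1 := hR.mul_apply hX1 (i := ⟨j - 1, by omega⟩) (m := ⟨j - 1, by omega⟩)
      (j := ⟨j, by omega⟩) rfl (by simp; omega)
    rw [hRX, h0, mul_zero, h.left.tridiagonal.upperBand.mul_apply hR (m := ⟨j, by omega⟩)
      (by simp; omega) rfl] at h1
    exact mul_ne_zero (h.left.tridiagonal.2 _ _ (Or.inl (by simp; omega)))
      (hR.apply_self_ne_zero hRu _) h1
  · rw [hBX]
    congr 1
    ext i j
    by_cases hij : i = j
    · subst hij; simp [upperBidiagonal, hXd]
    · by_cases hs : j.val = i.val + 1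
      · have hi : i = ⟨j.val - 1, by omega⟩ := Fin.ext (by simp; omega)
        have hc : 1 ≤ j.val ∧ j.val ≤ d := by omega
        simp only [upperBidiagonal, of_apply, if_neg hij, if_pos hs, dif_pos hc]
        rw [hi]
      · simp only [upperBidiagonal, of_apply, if_neg hij, if_neg hs]
        have hne : i.val ≠ j.val := fun e => hij (Fin.ext e)
        rcases lt_or_gt_of_ne hne with hlt | hlt
        · exact hX1 i j (by omega)
        · exact hX0 j i (by omega)

end Split

-- Polynomials in a matrix

section Functional

variable {K : Type*} [Field K] {n : Type*} [Fintype n] [DecidableEq n]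

theorem aeval_mul_eq_mul_aeval {A P M : Matrix n n K} (h : A * P = P * M) (p : K[X]) :
    aeval A p * P = P * aeval M p := by
  induction p using Polynomial.induction_on' with
  | add p q hp hq => rw [map_add, map_add, add_mul, mul_add, hp, hq]
  | monomial k a =>
    have hk : A ^ k * P = P * M ^ k := by
      induction k with
      | zero => simp
      | succ k ih => rw [pow_succ, Matrix.mul_assoc, h, ← Matrix.mul_assoc, ih, pow_succ,
          Matrix.mul_assoc]
    rw [aeval_monomial, aeval_monomial, ← Algebra.smul_def, ← Algebra.smul_def, smul_mul_assoc,
      mul_smul_comm, hk]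

theorem aeval_diagonal (f : n → K) (p : K[X]) :
    aeval (diagonal f) p = diagonal fun i => p.eval (f i) := by
  induction p using Polynomial.induction_on' with
  | add p q hp hq => rw [map_add, hp, hq, diagonal_add]; simp
  | monomial k a =>
    rw [aeval_monomial, ← Algebra.smul_def, diagonal_pow, ← diagonal_smul]
    congr 1
    ext i
    simp

theorem aeval_transpose (A : Matrix n n K) (p : K[X]) : aeval Aᵀ p = (aeval A p)ᵀ := by
  induction p using Polynomial.induction_on' with
  | add p q hp hq => rw [map_add, map_add, hp, hq, transpose_add]
  | monomial k a =>
    rw [aeval_monomial, aeval_monomial, ← Algebra.smul_def, ← Algebra.smul_def, transpose_smul,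
      transpose_pow]

end Functional

-- Primitive idempotents, and the split sequence as a ratio of traces

section Idempotent

variable {K : Type*} [Field K] {d : ℕ}

theorem tau_succ (θ : ℕ → K) (j : ℕ) : tau θ (j + 1) = tau θ j * (X - C (θ j)) :=
  Finset.prod_range_succ _ _

theorem eval_tau (θ : ℕ → K) (j : ℕ) (x : K) :
    (tau θ j).eval x = ∏ h ∈ Finset.range j, (x - θ h) := by
  simp [tau, eval_prod]

theorem eval_tau_eq_zero (θ : ℕ → K) {i j : ℕ} (h : i < j) : (tau θ j).eval (θ i) = 0 := by
  rw [eval_tau]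
  exact Finset.prod_eq_zero (Finset.mem_range.2 h) (sub_self _)

theorem eval_primitiveIdempotent {θ : ℕ → K} (hθ : Set.InjOn θ (Set.Iic d)) {i j : ℕ}
    (hi : i ≤ d) (hj : j ≤ d) :
    (∏ k ∈ (Finset.range (d + 1)).erase i, (C (θ i - θ k)⁻¹ * (X - C (θ k)))).eval (θ j) =
      if j = i then 1 else 0 := by
  rw [eval_prod]
  split_ifs with h
  · subst h
    refine Finset.prod_eq_one fun k hk => ?_
    rw [Finset.mem_erase, Finset.mem_range] at hk
    have : θ j - θ k ≠ 0 := sub_ne_zero.2 fun e =>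
      hk.1 (hθ (Set.mem_Iic.2 hj) (Set.mem_Iic.2 (by omega)) e).symm
    simp [this]
  · exact Finset.prod_eq_zero (i := j) (by simp; omega) (by simp)

variable {A B P Q W : Matrix (Fin (d + 1)) (Fin (d + 1)) K} {θ θs : ℕ → K}

theorem primitiveIdempotent_mul (hθ : Set.InjOn θ (Set.Iic d))
    (h : A * P = P * diagonal fun i : Fin (d + 1) => θ i) (i : Fin (d + 1)) :
    primitiveIdempotent d A θ i * P = P * diagonal (Pi.single i 1) := by
  rw [primitiveIdempotent, aeval_mul_eq_mul_aeval h, aeval_diagonal]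
  congr 2
  ext j
  rw [eval_primitiveIdempotent hθ (by omega) (by omega)]
  simp [Pi.single_apply, Fin.ext_iff]

/-- The rank one form turns traces against an idempotent into single coordinates, and later
identifies the module `V`. -/
theorem primitiveIdempotent_eq (hθ : Set.InjOn θ (Set.Iic d)) (hP : IsUnit P)
    (h : A * P = P * diagonal fun i : Fin (d + 1) => θ i) (i : Fin (d + 1)) :
    primitiveIdempotent d A θ i = vecMulVec (P.col i) (P⁻¹.row i) := by
  rw [Matrix.isUnit_iff_isUnit_det] at hP
  rw [← Matrix.mul_nonsing_inv_cancel_right P (primitiveIdempotent d A θ i) hP]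
  rw [primitiveIdempotent_mul hθ h]
  ext a b
  rw [Matrix.mul_assoc, Matrix.mul_apply, Finset.sum_eq_single i]
  · simp [vecMulVec_apply]
  · intro c _ hc
    simp [hc]
  · simp

theorem primitiveIdempotent_transpose (B : Matrix (Fin (d + 1)) (Fin (d + 1)) K) (θs : ℕ → K)
    (i : ℕ) : primitiveIdempotent d Bᵀ θs i = (primitiveIdempotent d B θs i)ᵀ :=
  aeval_transpose _ _

/-- The matrix with columns `τ_0(A) v, …, τ_d(A) v`. -/
noncomputable def tauColumns (A : Matrix (Fin (d + 1)) (Fin (d + 1)) K) (θ : ℕ → K) (v : Fin (d + 1) → K) :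
    Matrix (Fin (d + 1)) (Fin (d + 1)) K :=
  Matrix.of fun i j => (aeval A (tau θ j.val) *ᵥ v) i

theorem mul_tauColumns_apply (M A : Matrix (Fin (d + 1)) (Fin (d + 1)) K) (θ : ℕ → K)
    (v : Fin (d + 1) → K) (i j : Fin (d + 1)) :
    (M * tauColumns A θ v) i j = ((M * aeval A (tau θ j.val)) *ᵥ v) i := by
  rw [← mulVec_mulVec]
  rfl

theorem aeval_tau_eq_zero (hP : IsUnit P) (h : A * P = P * diagonal fun i : Fin (d + 1) => θ i) :
    aeval A (tau θ (d + 1)) = 0 := by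
  have h1 := aeval_mul_eq_mul_aeval h (tau θ (d + 1))
  rw [aeval_diagonal] at h1
  have h2 : (diagonal fun i : Fin (d + 1) => (tau θ (d + 1)).eval (θ i)) = 0 := by
    rw [← diagonal_zero]
    congr 1
    ext i
    exact eval_tau_eq_zero θ i.isLt
  rw [h2, mul_zero] at h1
  rw [Matrix.isUnit_iff_isUnit_det] at hP
  rw [← Matrix.mul_nonsing_inv_cancel_right P (aeval A _) hP, h1, Matrix.zero_mul]

/-- This is `τ_{j+1} = (λ - θ_j) τ_j`; the hypothesis `h0` closes the last column. -/
theorem mul_tauColumns (h0 : aeval A (tau θ (d + 1)) = 0) (v : Fin (d + 1) → K) :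
    A * tauColumns A θ v = tauColumns A θ v * lowerBidiagonal d θ := by
  have hmul : ∀ j, aeval A (tau θ (j + 1)) = A * aeval A (tau θ j) - θ j • aeval A (tau θ j) := by
    intro j
    rw [tau_succ, mul_comm, map_mul, map_sub, aeval_X, aeval_C, sub_mul, ← Algebra.smul_def]
  ext i j
  rw [mul_tauColumns_apply]
  by_cases hj : j.val = d
  · rw [mul_lowerBidiagonal_of_eq _ _ _ _ hj]
    have := hmul j
    rw [show j.val + 1 = d + 1 by omega, h0, eq_comm, sub_eq_zero] at this
    rw [this, smul_mulVec, Pi.smul_apply, smul_eq_mul, mul_comm]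
    rfl
  · rw [mul_lowerBidiagonal_of_succ _ _ _ j ⟨j + 1, by omega⟩ rfl]
    simp only [tauColumns, of_apply, hmul j, sub_mulVec, Pi.sub_apply, smul_mulVec,
      Pi.smul_apply, smul_eq_mul]
    ring

theorem tauColumns_zero (A : Matrix (Fin (d + 1)) (Fin (d + 1)) K) (θ : ℕ → K)
    (v : Fin (d + 1) → K) (i : Fin (d + 1)) : tauColumns A θ v i 0 = v i := by
  simp [tauColumns, tau]

/-- The split sequence `(θ^*_0 - θ^*_i) tr(τ_i(A) E^*_0) / tr(τ_{i-1}(A) E^*_0)`. -/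
noncomputable def splitSequence (d : ℕ) (A B : Matrix (Fin (d + 1)) (Fin (d + 1)) K) (θ θs : ℕ → K) (i : ℕ) :
    K :=
  (θs 0 - θs i) * ((aeval A (tau θ i) * primitiveIdempotent d B θs 0).trace /
    (aeval A (tau θ (i - 1)) * primitiveIdempotent d B θs 0).trace)

theorem upperBidiagonal_congr {φ φ' : ℕ → K} (h : ∀ i, 1 ≤ i → i ≤ d → φ i = φ' i) :
    upperBidiagonal d θs φ = upperBidiagonal d θs φ' := by
  ext i j
  by_cases hij : i = j
  · simp [upperBidiagonal, hij]
  · by_cases hj : j.val = i.val + 1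
    · simp [upperBidiagonal, hij, hj, h (i.val + 1) (by omega) (by omega)]
    · simp [upperBidiagonal, hij, hj]

theorem IsSystem.trace_eq (h : IsSystem A B θ θs P Q) (j : Fin (d + 1)) :
    (aeval A (tau θ j) * primitiveIdempotent d B θs 0).trace =
      (Q⁻¹ * tauColumns A θ (Q.col 0)) 0 j := by
  have := primitiveIdempotent_eq h.injOn_dual h.right.isUnit h.right.mul_eq 0
  rw [Fin.val_zero] at this
  rw [this, mul_vecMulVec, trace_vecMulVec, mul_tauColumns_apply, ← mulVec_mulVec,
    dotProduct_comm]
  rfl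

/-- The superdiagonal found by `IsSystem.split` is identified by row 0 of `D C = C U`, with `D` the
diagonal of the `θs i`, `U` the upper bidiagonal matrix and `C = Q⁻¹ W`: it gives `(θs 0 - θs k)
C_{0k} = C_{0,k-1} φ_k`, and `C_{0k}` is the trace of `τ_k(A) E^*_0`. -/
theorem IsSystem.splitSequence_spec (h : IsSystem A B θ θs P Q) :
    IsUnit (tauColumns A θ (Q.col 0)) ∧
    A * tauColumns A θ (Q.col 0) = tauColumns A θ (Q.col 0) * lowerBidiagonal d θ ∧
    B * tauColumns A θ (Q.col 0) =
      tauColumns A θ (Q.col 0) * upperBidiagonal d θs (splitSequence d A B θ θs) ∧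
    ∀ i, 1 ≤ i → i ≤ d → splitSequence d A B θ θs i ≠ 0 := by
  have htr := h.trace_eq
  have hQ := (Matrix.isUnit_iff_isUnit_det Q).1 h.right.isUnit
  have hAW := mul_tauColumns (aeval_tau_eq_zero h.left.isUnit h.left.mul_eq) (Q.col 0)
  have hW0 := tauColumns_zero A θ (Q.col 0)
  set W := tauColumns A θ (Q.col 0) with hWdef
  have hBW : ∀ i, (B * W) i 0 = θs 0 * W i 0 := by
    intro i
    have h1 := congrFun (congrFun h.right.mul_eq i) 0
    rw [mul_diagonal, Matrix.mul_apply] at h1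
    rw [Matrix.mul_apply, hW0, mul_comm (θs 0)]
    simp only [hW0]
    exact h1
  have hWne : ∃ i, W i 0 ≠ 0 := by
    by_contra hcon
    push Not at hcon
    have h1 : (Q⁻¹ * Q) 0 0 = 0 := by
      rw [Matrix.mul_apply]
      refine Finset.sum_eq_zero fun k _ => ?_
      have := hcon k
      rw [hW0] at this
      rw [show Q k 0 = 0 from this, mul_zero]
    rw [Matrix.nonsing_inv_mul Q hQ] at h1
    simp at h1
  obtain ⟨hWu, φ, hφ, hBWφ⟩ := h.split hAW hBW hWne
  have hDC : diagonal (fun i : Fin (d + 1) => θs i) * (Q⁻¹ * W) =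
      (Q⁻¹ * W) * upperBidiagonal d θs φ := by
    rw [← Matrix.mul_assoc, ← inv_mul_eq_of_mul_eq h.right.isUnit h.right.mul_eq,
      Matrix.mul_assoc, hBWφ, Matrix.mul_assoc]
  have hrec : ∀ j k : Fin (d + 1), k.val = j.val + 1 →
      (θs 0 - θs k) * (Q⁻¹ * W) 0 k = (Q⁻¹ * W) 0 j * φ k := by
    intro j k hjk
    have h1 := mul_upperBidiagonal_of_succ (Q⁻¹ * W) θs φ 0 k j hjk
    rw [← hDC, diagonal_mul, Fin.val_zero] at h1
    linear_combination h1
  have hne : ∀ m : ℕ, ∀ j : Fin (d + 1), j.val = m → (Q⁻¹ * W) 0 j ≠ 0 := by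
    intro m
    induction m with
    | zero =>
      intro j hj
      obtain rfl : j = 0 := Fin.ext hj
      exact (h.right.split_lower h.injOn_dual hAW hBW hWne).2 0
    | succ m ih =>
      intro j hj h0
      have h1 := hrec ⟨m, by omega⟩ j hj
      rw [h0, mul_zero] at h1
      exact mul_ne_zero (ih ⟨m, by omega⟩ rfl) (hφ j (by omega) (by omega)) h1.symm
  have hφeq : ∀ i, 1 ≤ i → i ≤ d → φ i = splitSequence d A B θ θs i := by
    intro i hi1 hid
    have h1 := hrec ⟨i - 1, by omega⟩ ⟨i, by omega⟩ (by simp; omega)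
    have h2 := hne (i - 1) ⟨i - 1, by omega⟩ rfl
    have h3 := htr ⟨i - 1, by omega⟩
    have h4 := htr ⟨i, by omega⟩
    simp only at h1 h2 h3 h4
    rw [splitSequence, h3, h4]
    field_simp
    linear_combination -h1
  refine ⟨hWu, hAW, ?_, fun i h1 h2 => hφeq i h1 h2 ▸ hφ i h1 h2⟩
  rw [hBWφ, upperBidiagonal_congr hφeq]

end Idempotent

-- The second split basis, by transposition and reversal

section SecondSplit

variable {K : Type*} [Field K] {d : ℕ}
  {A B P Q : Matrix (Fin (d + 1)) (Fin (d + 1)) K} {θ θs : ℕ → K}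

theorem lowerBidiagonal_reverse_transpose (θ : ℕ → K) :
    (lowerBidiagonal d fun i => θ (d - i))ᵀ.submatrix Fin.rev Fin.rev = lowerBidiagonal d θ := by
  ext i j
  have h1 : (d + 1 - (j.val + 1) = d + 1 - (i.val + 1) + 1) ↔ i.val = j.val + 1 := by omega
  have h2 : d - (d + 1 - (j.val + 1)) = j.val := by omega
  by_cases hij : i = j
  · subst hij
    simp only [lowerBidiagonal, submatrix_apply, transpose_apply, of_apply, Fin.val_rev,
      if_true, h2]
  · have hji : ¬ j = i := fun e => hij e.symm
    simp only [lowerBidiagonal, submatrix_apply, transpose_apply, of_apply, Fin.val_rev,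
      Fin.rev_inj, hij, hji, if_false, h1]

theorem upperBidiagonal_transpose_reverse (θs ψ : ℕ → K) :
    (upperBidiagonal d θs ψ)ᵀ.submatrix Fin.rev Fin.rev =
      upperBidiagonal d (fun i => θs (d - i)) fun i => ψ (d - i + 1) := by
  ext i j
  have h1 : (d + 1 - (i.val + 1) = d + 1 - (j.val + 1) + 1) ↔ j.val = i.val + 1 := by omega
  have h2 : d + 1 - (j.val + 1) = d - j.val := by omega
  by_cases hij : i = j
  · subst hij; simp [upperBidiagonal, Fin.val_rev, h2]
  · have hji : ¬ j = i := fun e => hij e.symm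
    simp only [upperBidiagonal, submatrix_apply, transpose_apply, of_apply, Fin.val_rev,
      Fin.rev_inj, hij, hji, if_false, h1]
    split_ifs with h
    · congr 1; omega
    · rfl

/-- Passing to the inverse transpose exchanges lower and upper bidiagonal shapes; reversing the
order of the basis exchanges them back. -/
theorem mul_eq_of_transpose_mul {A W L L' : Matrix (Fin (d + 1)) (Fin (d + 1)) K}
    (hW : IsUnit W) (h : Aᵀ * W = W * L) (hL : Lᵀ.submatrix Fin.rev Fin.rev = L') :
    A * (Wᵀ)⁻¹.submatrix id Fin.rev = (Wᵀ)⁻¹.submatrix id Fin.rev * L' := by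
  have hWd : IsUnit (Wᵀ).det := by
    rw [det_transpose]; exact (Matrix.isUnit_iff_isUnit_det W).1 hW
  have h1 : Wᵀ * A = Lᵀ * Wᵀ := by
    rw [← transpose_mul, ← h, transpose_mul, transpose_transpose]
  have h2 : A * (Wᵀ)⁻¹ = (Wᵀ)⁻¹ * Lᵀ := by
    rw [← Matrix.nonsing_inv_mul_cancel_left Wᵀ (A * (Wᵀ)⁻¹) hWd, ← Matrix.mul_assoc Wᵀ, h1,
      Matrix.mul_nonsing_inv_cancel_right _ _ hWd]
  have h3 := submatrix_mul_equiv (Wᵀ)⁻¹ Lᵀ id Fin.revPerm Fin.rev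
  rw [← hL]
  have h4 := submatrix_mul_equiv A (Wᵀ)⁻¹ id (Equiv.refl _) Fin.rev
  rw [h2] at h4
  simp only [Equiv.coe_refl, submatrix_id_id] at h4
  exact h4.trans h3.symm

theorem splitSequence_transpose (A B : Matrix (Fin (d + 1)) (Fin (d + 1)) K) (θ θs : ℕ → K)
    (i : ℕ) : splitSequence d Aᵀ Bᵀ θ θs i = splitSequence d A B θ θs i := by
  have h : ∀ p : K[X], (aeval Aᵀ p * primitiveIdempotent d Bᵀ θs 0).trace =
      (aeval A p * primitiveIdempotent d B θs 0).trace := by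
    intro p
    rw [aeval_transpose, primitiveIdempotent_transpose, ← transpose_mul, trace_transpose,
      trace_mul_comm]
  simp only [splitSequence, h]

/-- A basis in which `A` is lower bidiagonal and `B` is upper bidiagonal with reversed
diagonal. -/
theorem IsSystem.exists_reversed_split (h : IsSystem A B θ θs P Q) :
    (∃ H : Matrix (Fin (d + 1)) (Fin (d + 1)) K, IsUnit H ∧ A * H = H * lowerBidiagonal d θ ∧
      B * H = H * upperBidiagonal d (fun i => θs (d - i)) fun i =>
        splitSequence d A B (fun i => θ (d - i)) θs (d - i + 1)) ∧
    ∀ i, 1 ≤ i → i ≤ d → splitSequence d A B (fun i => θ (d - i)) θs i ≠ 0 := by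
  obtain ⟨hWu, hA, hB, hne⟩ := h.transpose.reverse.splitSequence_spec
  simp only [splitSequence_transpose] at hne
  refine ⟨⟨_, ?_, mul_eq_of_transpose_mul hWu hA (lowerBidiagonal_reverse_transpose θ), ?_⟩, hne⟩
  · refine (Matrix.isUnit_submatrix_equiv (Equiv.refl _) Fin.revPerm).2 ?_
    rw [Matrix.isUnit_iff_isUnit_det] at hWu ⊢
    rw [← det_transpose] at hWu
    exact Matrix.isUnit_nonsing_inv_det _ hWu
  · refine mul_eq_of_transpose_mul hWu hB ?_
    rw [upperBidiagonal_transpose_reverse]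
    simp only [splitSequence_transpose]

end SecondSplit

-- The common recurrence of the two eigenvalue sequences

section Base

variable {K : Type*} [Field K] {n : ℕ}

theorem UpperBand.pow {M : Matrix (Fin n) (Fin n) K} (h : UpperBand 1 M) (k : ℕ) :
    UpperBand k (M ^ k) := by
  induction k with
  | zero => rw [pow_zero]; exact upperBand_one
  | succ k ih => rw [pow_succ]; exact ih.mul h

/-- Exactly one path of length `k` climbs `k` levels, and all its steps are nonzero. -/
theorem IsIrredTridiagonal.pow_apply_ne_zero {M : Matrix (Fin n) (Fin n) K}
    (h : IsIrredTridiagonal M) (k : ℕ) {i j : Fin n} (hij : j.val = i.val + k) :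
    (M ^ k) i j ≠ 0 := by
  induction k generalizing j with
  | zero =>
    obtain rfl : i = j := Fin.ext hij.symm
    simp
  | succ k ih =>
    rw [pow_succ, (h.upperBand.pow k).mul_apply h.upperBand (m := ⟨i.val + k, by omega⟩) rfl
      (by simp; omega)]
    exact mul_ne_zero (ih rfl) (h.2 _ _ (Or.inl (by simp; omega)))

theorem UpperBand.aeval_apply {M : Matrix (Fin n) (Fin n) K} (h : UpperBand 1 M) (p : K[X])
    {k : ℕ} (hp : p.natDegree ≤ k) {i j : Fin n} (hij : j.val = i.val + k) :
    (aeval M p) i j = p.coeff k * (M ^ k) i j := by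
  rw [aeval_eq_sum_range' (Nat.lt_succ_of_le hp), Matrix.sum_apply, Finset.sum_eq_single k]
  · simp
  · intro b hb hbk
    rw [Finset.mem_range] at hb
    rw [Matrix.smul_apply, h.pow b i j (by omega), smul_zero]
  · simp

/-- The eigenvalue sequences of a system satisfy a common three-term recurrence on
differences. -/
theorem IsSystem.exists_recurrence {d : ℕ} {A B P Q : Matrix (Fin (d + 1)) (Fin (d + 1)) K}
    {θ θs : ℕ → K} (h : IsSystem A B θ θs P Q) (hd : 3 ≤ d) :
    ∃ c : K, c ≠ 0 ∧ ∀ i, 2 ≤ i → i + 1 ≤ d →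
      θ (i - 1) - θ i = c * (θ (i - 2) - θ (i + 1)) ∧
      θs (i - 1) - θs i = c * (θs (i - 2) - θs (i + 1)) := by
  have hθ : ∀ i j, i ≤ d → j ≤ d → i ≠ j → θ i - θ j ≠ 0 := fun i j hi hj hij =>
    sub_ne_zero.2 fun e => hij (h.injOn hi hj e)
  have hθs : ∀ i j, i ≤ d → j ≤ d → i ≠ j → θs i - θs j ≠ 0 := fun i j hi hj hij =>
    sub_ne_zero.2 fun e => hij (h.injOn_dual hi hj e)
  -- Chosen so that the eigenvalue `z i` of `p(A)` makes the `(i, i ± 1)` entries of the commutator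
  -- identity agree; a tridiagonal `B` imposes no other condition.
  let z : ℕ → K := fun i => -∑ k ∈ Finset.range i, θ k * θ (k + 1) * (θ k - θ (k + 1))
  have hz : ∀ i, z i - z (i + 1) = θ i * θ (i + 1) * (θ i - θ (i + 1)) := by
    intro i; simp only [z, Finset.sum_range_succ]; ring
  let p : K[X] := Lagrange.interpolate (Finset.range (d + 1)) θ z
  have hinj : Set.InjOn θ (Finset.range (d + 1) : Finset ℕ) := by
    intro i hi j hj hij
    rw [Finset.mem_coe, Finset.mem_range] at hi hj
    exact h.injOn (Set.mem_Iic.2 (by omega)) (Set.mem_Iic.2 (by omega)) hij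
  have hp : ∀ i, i ≤ d → p.eval (θ i) = z i := fun i hi =>
    Lagrange.eval_interpolate_at_node z hinj (Finset.mem_range.2 (by omega))
  have hpd : p.natDegree ≤ d := by
    refine natDegree_le_of_degree_le ?_
    have := Lagrange.degree_interpolate_le z hinj
    rwa [Finset.card_range, Nat.add_sub_cancel] at this
  have hPd := (Matrix.isUnit_iff_isUnit_det P).1 h.left.isUnit
  have hQd := (Matrix.isUnit_iff_isUnit_det Q).1 h.right.isUnit
  -- the commutator identity, first in the eigenbasis of `A`
  have hcomm : A * A * B * A - A * B * (A * A) = aeval A p * B - B * aeval A p := by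
    set D := diagonal (fun i : Fin (d + 1) => θ i) with hD
    obtain ⟨N, hN⟩ : ∃ N, N = P⁻¹ * B * P := ⟨_, rfl⟩
    have hT := h.left.tridiagonal
    rw [← hN] at hT
    have hB : B * P = P * N := by
      rw [hN, Matrix.mul_assoc, Matrix.mul_nonsing_inv_cancel_left P _ hPd]
    have hpA := aeval_mul_eq_mul_aeval h.left.mul_eq p
    rw [aeval_diagonal] at hpA
    have hA := h.left.mul_eq
    rw [← hD] at hA
    have key : D * D * N * D - D * N * (D * D) =
        diagonal (fun i : Fin (d + 1) => p.eval (θ i)) * N -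
          N * diagonal (fun i : Fin (d + 1) => p.eval (θ i)) := by
      ext i j
      rw [hD, diagonal_mul_diagonal]
      simp only [Matrix.sub_apply, mul_diagonal, diagonal_mul]
      rw [hp i (by omega), hp j (by omega)]
      by_cases hij : i = j
      · subst hij; ring
      · by_cases h1 : j.val = i.val + 1
        · have := hz i
          rw [h1]
          linear_combination -N i j * this
        · by_cases h2 : i.val = j.val + 1
          · have := hz j
            rw [h2]
            linear_combination N i j * this
          · have hne : i.val ≠ j.val := fun e => hij (Fin.ext e)
            rw [hT.1 i j (by omega)]
            ring
    have conj : ∀ X Y X' Y' : Matrix (Fin (d + 1)) (Fin (d + 1)) K, X * P = P * X' →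
        Y * P = P * Y' → X * Y * P = P * (X' * Y') := by
      intro X Y X' Y' hX hY
      rw [Matrix.mul_assoc, hY, ← Matrix.mul_assoc, hX, Matrix.mul_assoc]
    have hAA := conj _ _ _ _ hA hA
    have h1 := conj _ _ _ _ (conj _ _ _ _ hAA hB) hA
    have h2 := conj _ _ _ _ (conj _ _ _ _ hA hB) hAA
    have h3 := conj _ _ _ _ hpA hB
    have h4 := conj _ _ _ _ hB hpA
    have h5 : (A * A * B * A - A * B * (A * A)) * P = (aeval A p * B - B * aeval A p) * P := by
      rw [sub_mul, sub_mul, h1, h2, h3, h4, ← mul_sub, ← mul_sub, key]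
    have := congrArg (· * P⁻¹) h5
    simpa [Matrix.mul_nonsing_inv_cancel_right _ _ hPd] using this
  -- then in the eigenbasis of `B`
  obtain ⟨M, hM⟩ : ∃ M, M = Q⁻¹ * A * Q := ⟨_, rfl⟩
  have hT := h.right.tridiagonal
  rw [← hM] at hT
  set D := diagonal (fun i : Fin (d + 1) => θs i) with hD
  have hcomm' : M * M * D * M - M * D * (M * M) = aeval M p * D - D * aeval M p := by
    have hA : A * Q = Q * M := by
      rw [hM, Matrix.mul_assoc, Matrix.mul_nonsing_inv_cancel_left Q _ hQd]
    have hpA := aeval_mul_eq_mul_aeval hA p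
    have hB := h.right.mul_eq
    rw [← hD] at hB
    have conj : ∀ X Y X' Y' : Matrix (Fin (d + 1)) (Fin (d + 1)) K, X * Q = Q * X' →
        Y * Q = Q * Y' → X * Y * Q = Q * (X' * Y') := by
      intro X Y X' Y' hX hY
      rw [Matrix.mul_assoc, hY, ← Matrix.mul_assoc, hX, Matrix.mul_assoc]
    have hAA := conj _ _ _ _ hA hA
    have h1 := conj _ _ _ _ (conj _ _ _ _ hAA hB) hA
    have h2 := conj _ _ _ _ (conj _ _ _ _ hA hB) hAA
    have h3 := conj _ _ _ _ hpA hB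
    have h4 := conj _ _ _ _ hB hpA
    have h5 : Q * (M * M * D * M - M * D * (M * M)) = Q * (aeval M p * D - D * aeval M p) := by
      rw [mul_sub, mul_sub, ← h1, ← h2, ← h3, ← h4, ← sub_mul, ← sub_mul, hcomm]
    have := congrArg (Q⁻¹ * ·) h5
    simpa [Matrix.nonsing_inv_mul_cancel_left _ _ hQd] using this
  have hMb := hT.upperBand
  have hDb : UpperBand 0 D := upperBand_diagonal _
  have hMMb : UpperBand 2 (M * M) := hMb.mul hMb
  have hb1 : UpperBand 3 (M * M * D * M) := (hMMb.mul hDb).mul hMb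
  have hb2 : UpperBand 3 (M * D * (M * M)) := (hMb.mul hDb).mul hMMb
  have hentry : ∀ i j : Fin (d + 1), (M * M * D * M - M * D * (M * M)) i j =
      (aeval M p) i j * (θs j - θs i) := by
    intro i j
    rw [hcomm', Matrix.sub_apply, hD, mul_diagonal, diagonal_mul]
    ring
  -- The left side has bandwidth 3. If `p` had larger degree, the entry of `[p(A), B]` at distance
  -- `natDegree` from the diagonal would be its leading coefficient times nonzero factors.
  have hdeg : p.natDegree ≤ 3 := by
    by_contra hcon
    have h1 := hentry 0 ⟨p.natDegree, by omega⟩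
    rw [Matrix.sub_apply, hb1 _ _ (by simp; omega), hb2 _ _ (by simp; omega), sub_zero,
      hMb.aeval_apply p le_rfl (by simp)] at h1
    refine mul_ne_zero (mul_ne_zero ?_ (hT.pow_apply_ne_zero _ (by simp)))
      (hθs _ _ ?_ ?_ ?_) h1.symm
    · rw [coeff_natDegree, leadingCoeff_ne_zero]
      rintro e
      rw [e] at hcon; simp at hcon
    · simpa using hpd
    · simp
    · simp; omega
  -- Compare entries at distance exactly 3: each product has one path, and the cube of `M` cancels.
  have hdual : ∀ i, 2 ≤ i → i + 1 ≤ d →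
      θs (i - 1) - θs i = p.coeff 3 * (θs (i - 2) - θs (i + 1)) := by
    intro i hi hid
    have h1 := hentry ⟨i - 2, by omega⟩ ⟨i + 1, by omega⟩
    have e0 : (M * M * D * M) ⟨i - 2, by omega⟩ ⟨i + 1, by omega⟩ =
        (M * M * M) ⟨i - 2, by omega⟩ ⟨i + 1, by omega⟩ * θs i := by
      rw [(hMMb.mul hDb).mul_apply hMb (m := ⟨i, by omega⟩) (by simp; omega) (by simp),
        hMMb.mul_apply hMb (m := ⟨i, by omega⟩) (by simp; omega) (by simp), hD, mul_diagonal]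
      ring
    have e1 : (M * D * (M * M)) ⟨i - 2, by omega⟩ ⟨i + 1, by omega⟩ =
        (M * M * M) ⟨i - 2, by omega⟩ ⟨i + 1, by omega⟩ * θs (i - 1) := by
      rw [(hMb.mul hDb).mul_apply hMMb (m := ⟨i - 1, by omega⟩) (by simp; omega)
        (by simp; omega), Matrix.mul_assoc M M M,
        hMb.mul_apply hMMb (m := ⟨i - 1, by omega⟩) (by simp; omega) (by simp; omega), hD,
        mul_diagonal]
      ring
    have e2 : M ^ 3 = M * M * M := by rw [pow_succ, pow_two]
    have hne := hT.pow_apply_ne_zero 3 (i := ⟨i - 2, by omega⟩) (j := ⟨i + 1, by omega⟩)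
      (by simp; omega)
    rw [Matrix.sub_apply, e0, e1, hMb.aeval_apply p hdeg (by simp; omega), ← e2] at h1
    refine mul_left_cancel₀ hne ?_
    linear_combination -h1
  have hpeval : ∀ x, p.eval x = p.coeff 3 * x ^ 3 + p.coeff 2 * x ^ 2 + p.coeff 1 * x +
      p.coeff 0 := by
    intro x
    rw [eval_eq_sum_range' (Nat.lt_succ_of_le hdeg)]
    simp only [Finset.sum_range_succ, Finset.sum_range_zero]
    ring
  -- With `p` cubic, the defining relation of `z` is divided by `θ i - θ (i + 1)`; the difference of
  -- two neighbouring instances is then divided by `θ i - θ (i + 2)`.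
  have hθ1 : ∀ i, i + 1 ≤ d → θ i * θ (i + 1) = p.coeff 3 * (θ i ^ 2 + θ i * θ (i + 1) +
      θ (i + 1) ^ 2) + p.coeff 2 * (θ i + θ (i + 1)) + p.coeff 1 := by
    intro i hi
    have h1 := hz i
    rw [← hp i (by omega), ← hp (i + 1) hi, hpeval, hpeval] at h1
    refine mul_right_cancel₀ (hθ i (i + 1) (by omega) hi (by omega)) ?_
    linear_combination -h1
  have hθ2 : ∀ i, i + 2 ≤ d →
      θ (i + 1) = p.coeff 3 * (θ i + θ (i + 1) + θ (i + 2)) + p.coeff 2 := by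
    intro i hi
    refine mul_right_cancel₀ (hθ i (i + 2) (by omega) hi (by omega)) ?_
    linear_combination hθ1 i (by omega) - hθ1 (i + 1) (by omega)
  refine ⟨p.coeff 3, ?_, fun i hi hid => ⟨?_, hdual i hi hid⟩⟩
  · intro h0
    have := hdual 2 le_rfl hd
    rw [h0, zero_mul] at this
    exact hθs 1 2 (by omega) (by omega) (by omega) this
  · obtain ⟨k, rfl⟩ : ∃ k, i = k + 2 := ⟨i - 2, by omega⟩
    have h1 := hθ2 k (by omega)
    have h2 := hθ2 (k + 1) (by omega)
    simp only [show k + 2 - 1 = k + 1 by omega, show k + 2 - 2 = k by omega]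
    linear_combination h1 - h2

end Base

end Leonard

namespace Leonard

-- Recurrent sequences in closed form and the bracket identity

section Bracket

variable {F : Type*} [Field F]

/-- `x_0, …, x_d` are distinct and `q`-recurrent. -/
structure IsRecurrent (d : ℕ) (q : F) (x : ℕ → F) : Prop where
  ne_zero : q ≠ 0
  injOn : Set.InjOn x (Set.Iic d)
  sub_eq : ∀ k, k + 3 ≤ d → x k - x (k + 3) = (q + q⁻¹ + 1) * (x (k + 1) - x (k + 2))

variable {d : ℕ} {q : F} {x : ℕ → F}

theorem IsRecurrent.eq_of_sub_eq (h : IsRecurrent d q x) {y : ℕ → F}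
    (hy : ∀ k, y k - y (k + 3) = (q + q⁻¹ + 1) * (y (k + 1) - y (k + 2)))
    (h0 : x 0 = y 0) (h1 : x 1 = y 1) (h2 : x 2 = y 2) : ∀ i, i ≤ d → x i = y i := by
  intro i
  induction i using Nat.strong_induction_on with
  | _ i ih =>
    intro hi
    match i, ih, hi with
    | 0, _, _ => exact h0
    | 1, _, _ => exact h1
    | 2, _, _ => exact h2
    | k + 3, ih, hi =>
      have e := h.sub_eq k hi
      rw [ih k (by omega) (by omega), ih (k + 1) (by omega) (by omega),
        ih (k + 2) (by omega) (by omega), ← hy k] at e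
      linear_combination -e

theorem IsRecurrent.sub_ne_zero (h : IsRecurrent d q x) {i : ℕ} (h0 : 0 < i) (hi : i ≤ d) :
    x i - x 0 ≠ 0 := _root_.sub_ne_zero.2 fun e => h0.ne' (h.injOn hi (Nat.zero_le d) e)

theorem IsRecurrent.reverse (h : IsRecurrent d q x) : IsRecurrent d q fun i => x (d - i) := by
  refine ⟨h.ne_zero, injOn_reverse h.injOn, fun k hk => ?_⟩
  have e := h.sub_eq (d - (k + 3)) (by omega)
  rw [show d - (k + 3) + 3 = d - k by omega, show d - (k + 3) + 1 = d - (k + 2) by omega,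
    show d - (k + 3) + 2 = d - (k + 1) by omega] at e
  linear_combination -e

theorem IsRecurrent.exists_of_ne (h : IsRecurrent d q x) (h1 : q ≠ 1) (h2 : q ≠ -1) :
    ∃ a b c : F, ∀ i, i ≤ d → x i = a + b * q ^ i + c * (q ^ i)⁻¹ := by
  have hq := h.ne_zero
  have e1 : q - 1 ≠ 0 := _root_.sub_ne_zero.2 h1
  have e2 : q + 1 ≠ 0 := fun e => h2 (eq_neg_of_add_eq_zero_left e)
  obtain ⟨b, c, hb, hc⟩ : ∃ b c : F, b * (q - 1) + c * (q⁻¹ - 1) = x 1 - x 0 ∧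
      b * (q ^ 2 - 1) + c * ((q ^ 2)⁻¹ - 1) = x 2 - x 0 := by
    -- Cramer's rule for the two linear equations in `b` and `c`; the denominator is nonzero since
    -- `q ≠ ±1`.
    refine ⟨((x 2 - x 0) * q - (x 1 - x 0) * (q + 1)) / ((q - 1) ^ 2 * (q + 1)),
      ((x 2 - x 0) - (q + 1) * (x 1 - x 0)) * q ^ 2 / ((q - 1) ^ 2 * (q + 1)), ?_, ?_⟩ <;>
    · field_simp
      ring
  refine ⟨x 0 - b - c, b, c, h.eq_of_sub_eq ?_ ?_ ?_ ?_⟩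
  · intro k
    have : q ^ k ≠ 0 := pow_ne_zero _ hq
    simp only [pow_succ]
    field_simp
    ring
  · rw [pow_zero, inv_one]; ring
  · rw [pow_one]; linear_combination -hb
  · linear_combination -hc

theorem IsRecurrent.exists_of_eq_one (h : IsRecurrent d q x) (h1 : q = 1) (h2 : (2 : F) ≠ 0) :
    ∃ a b c : F, ∀ i : ℕ, i ≤ d → x i = a + b * i + c * (i : F) ^ 2 := by
  obtain ⟨c, hc⟩ : ∃ c : F, 2 * c = x 2 - x 0 - 2 * (x 1 - x 0) :=
    ⟨(x 2 - x 0 - 2 * (x 1 - x 0)) / 2, by field_simp⟩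
  refine ⟨x 0, x 1 - x 0 - c, c, h.eq_of_sub_eq ?_ ?_ ?_ ?_⟩
  · intro k
    subst h1
    push_cast
    rw [inv_one]
    ring
  · simp
  · push_cast
    ring
  · push_cast
    linear_combination -hc

theorem IsRecurrent.exists_of_eq_neg_one (h : IsRecurrent d q x) (h1 : q = -1)
    (h2 : (2 : F) ≠ 0) :
    ∃ a b c : F, ∀ i : ℕ, i ≤ d → x i = a + b * (-1) ^ i + c * i * (-1) ^ i := by
  obtain ⟨c, hc⟩ : ∃ c : F, 2 * c = x 2 - x 0 := ⟨(x 2 - x 0) / 2, by field_simp⟩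
  obtain ⟨b, hb⟩ : ∃ b : F, 2 * b = x 0 - x 1 - c := ⟨(x 0 - x 1 - c) / 2, by field_simp⟩
  refine ⟨x 0 - b, b, c, h.eq_of_sub_eq ?_ ?_ ?_ ?_⟩
  · intro k
    subst h1
    have : (-1 : F)⁻¹ = -1 := by rw [inv_neg, inv_one]
    rw [this]
    push_cast
    simp only [pow_succ]
    ring
  · simp
  · push_cast
    linear_combination hb
  · push_cast
    linear_combination -hc

/-- Here `q + q⁻¹ + 1 = 1`, so any four consecutive terms sum to 0 in characteristic two; two
overlapping instances would give `x 4 = x 0`. -/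
theorem IsRecurrent.le_three (h : IsRecurrent d q x) (h1 : q = 1) (h2 : (2 : F) = 0) :
    d ≤ 3 := by
  by_contra hd
  refine h.sub_ne_zero (i := 4) (by norm_num) (by omega) ?_
  have e0 := h.sub_eq 0 (by omega)
  have e1 := h.sub_eq 1 (by omega)
  subst h1
  norm_num at e0 e1
  linear_combination -e0 - e1 + (x 3 - x 1) * h2

theorem tripleRatio_zero_left (f : ℕ → F) (h0 : f 0 = 1) {s t : ℕ} (hs : f s ≠ 0)
    (ht : f t ≠ 0) (hst : f (s + t) ≠ 0) : tripleRatio f 0 s t = 1 := by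
  rw [tripleRatio, h0, zero_add, zero_add]
  field_simp

theorem tripleRatio_zero_mid (f : ℕ → F) (h0 : f 0 = 1) {s t : ℕ} (hs : f s ≠ 0)
    (ht : f t ≠ 0) (hst : f (s + t) ≠ 0) : tripleRatio f s 0 t = 1 := by
  rw [tripleRatio, h0, zero_add, add_zero]
  field_simp

/-- Consecutive values of `tripleRatio` in terms of the ratios `h (n + 1) = f (n + 1) / f n`. -/
theorem tripleRatio_steps {f h : ℕ → F} (hf : ∀ n, f (n + 1) = f n * h (n + 1)) {r s t : ℕ}
    (hne : ∀ n, n ≤ r + s + t + 2 → f n ≠ 0) :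
    ∃ g : F, tripleRatio f (r + 1) (s + 1) t = g * (h (r + s + 2) * h (t + 1)) ∧
      tripleRatio f (r + 1) s (t + 1) = g * (h (r + t + 2) * h (s + 1)) ∧
      tripleRatio f r (s + 1) (t + 1) = g * (h (s + t + 2) * h (r + 1)) := by
  have hr := hne (r + 1) (by omega)
  have hs := hne (s + 1) (by omega)
  have ht := hne (t + 1) (by omega)
  have hd := hne (r + s + t + 2) le_rfl
  have hr' := hne r (by omega)
  have hs' := hne s (by omega)
  have ht' := hne t (by omega)
  have e1 := hf (r + s + 1)
  have e2 := hf (r + t + 1)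
  have e3 := hf (s + t + 1)
  -- The common factor `g` is what remains after removing the last factor from the long factorial of
  -- each numerator and extending the short one in the denominator.
  refine ⟨f (r + s + 1) * f (r + t + 1) * f (s + t + 1) /
    (f (r + 1) * f (s + 1) * f (t + 1) * f (r + s + t + 2)), ?_, ?_, ?_⟩
  · rw [tripleRatio, show r + 1 + (s + 1) = r + s + 1 + 1 by ring,
      show r + 1 + t = r + t + 1 by ring, show s + 1 + t = s + t + 1 by ring,
      show r + s + 1 + 1 + t = r + s + t + 2 by ring, e1, div_mul_eq_mul_div,
      div_eq_div_iff (mul_ne_zero (mul_ne_zero (mul_ne_zero hr hs) ht') hd)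
        (mul_ne_zero (mul_ne_zero (mul_ne_zero hr hs) ht) hd), hf t]
    ring
  · rw [tripleRatio, show r + 1 + (t + 1) = r + t + 1 + 1 by ring,
      show r + 1 + s = r + s + 1 by ring, show s + (t + 1) = s + t + 1 by ring,
      show r + s + 1 + (t + 1) = r + s + t + 2 by ring, e2, div_mul_eq_mul_div,
      div_eq_div_iff (mul_ne_zero (mul_ne_zero (mul_ne_zero hr hs') ht) hd)
        (mul_ne_zero (mul_ne_zero (mul_ne_zero hr hs) ht) hd), hf s]
    ring
  · rw [tripleRatio, show s + 1 + (t + 1) = s + t + 1 + 1 by ring,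
      show r + (s + 1) = r + s + 1 by ring, show r + (t + 1) = r + t + 1 by ring,
      show r + s + 1 + (t + 1) = r + s + t + 2 by ring, e3, div_mul_eq_mul_div,
      div_eq_div_iff (mul_ne_zero (mul_ne_zero (mul_ne_zero hr' hs) ht) hd)
        (mul_ne_zero (mul_ne_zero (mul_ne_zero hr hs) ht) hd), hf r]
    ring

theorem ne_zero_of_steps {f h : ℕ → F} (h0 : f 0 = 1) (hf : ∀ n, f (n + 1) = f n * h (n + 1))
    (hh : ∀ n, n + 1 ≤ d → h (n + 1) ≠ 0) : ∀ n, n ≤ d → f n ≠ 0 := by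
  intro n
  induction n with
  | zero => intro _; rw [h0]; exact one_ne_zero
  | succ n ih => intro hn; rw [hf]; exact mul_ne_zero (ih (by omega)) (hh n hn)

theorem qPoch_succ (q : F) (n : ℕ) : qPoch q (n + 1) = qPoch q n * (1 - q ^ (n + 1)) :=
  Finset.prod_range_succ _ _

/-- Distinctness of the `x i` keeps denominators nonzero: by the closed form, `q ^ n = 1` would give
`x n = x 0`. The two factorial analogues rest on the same argument. -/
theorem IsRecurrent.qPoch_ne_zero (h : IsRecurrent d q x) (h1 : q ≠ 1) (h2 : q ≠ -1) :
    ∀ n, n ≤ d → qPoch q n ≠ 0 := by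
  refine ne_zero_of_steps (h := fun n => 1 - q ^ n) (by simp [qPoch]) (qPoch_succ q) ?_
  intro n hn h0
  obtain ⟨a, b, c, hx⟩ := h.exists_of_ne h1 h2
  refine h.sub_ne_zero (Nat.succ_pos n) hn ?_
  rw [hx _ hn, hx 0 (Nat.zero_le d), show q ^ (n + 1) = 1 by linear_combination -h0]
  simp

theorem IsRecurrent.factorial_ne_zero (h : IsRecurrent d q x) (h1 : q = 1) (h2 : (2 : F) ≠ 0) :
    ∀ n, n ≤ d → ((Nat.factorial n : ℕ) : F) ≠ 0 := by
  refine ne_zero_of_steps (h := fun n => (n : F)) (by simp)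
    (fun n => by rw [Nat.factorial_succ]; push_cast; ring) ?_
  intro n hn h0
  obtain ⟨a, b, c, hx⟩ := h.exists_of_eq_one h1 h2
  refine h.sub_ne_zero (Nat.succ_pos n) hn ?_
  rw [hx _ hn, hx 0 (Nat.zero_le d), h0]
  simp

/-- Writing the ratio over 2, with numerator 2 at odd indices, puts the floor factorials in the form
required by `tripleRatio_steps`. -/
theorem half_factorial_succ (h2 : (2 : F) ≠ 0) (n : ℕ) :
    ((Nat.factorial ((n + 1) / 2) : ℕ) : F) = ((Nat.factorial (n / 2) : ℕ) : F) *
      ((if Even (n + 1) then ((n + 1 : ℕ) : F) else 2) / 2) := by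
  obtain ⟨m, rfl | rfl⟩ := n.even_or_odd'
  · have : ¬ Even (2 * m + 1) := by simp
    rw [if_neg this, show (2 * m + 1) / 2 = m by omega, show 2 * m / 2 = m by omega]
    field_simp
  · have : Even (2 * m + 1 + 1) := by simp [Nat.even_add_one]
    rw [if_pos this, show (2 * m + 1 + 1) / 2 = m + 1 by omega,
      show (2 * m + 1) / 2 = m by omega, Nat.factorial_succ]
    push_cast
    field_simp
    ring

theorem IsRecurrent.half_factorial_ne_zero (h : IsRecurrent d q x) (h1 : q = -1)
    (h2 : (2 : F) ≠ 0) : ∀ n, n ≤ d → ((Nat.factorial (n / 2) : ℕ) : F) ≠ 0 := by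
  refine ne_zero_of_steps (h := fun n => (if Even n then (n : F) else 2) / 2) (by simp)
    (half_factorial_succ h2) ?_
  intro n hn h0
  obtain ⟨a, b, c, hx⟩ := h.exists_of_eq_neg_one h1 h2
  rw [div_eq_zero_iff, or_iff_left h2] at h0
  split_ifs at h0 with he
  · refine h.sub_ne_zero (Nat.succ_pos n) hn ?_
    rw [hx _ hn, hx 0 (Nat.zero_le d), h0, he.neg_one_pow]
    simp
  · exact h2 h0

theorem IsRecurrent.bracket_zero_left (h : IsRecurrent d q x) {s t : ℕ} (hst : s + t ≤ d) :
    bracket q 0 s t = 1 := by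
  rw [bracket]
  split_ifs with h1 h2 h3 h4 h5
  · exact absurd h3 (by simp)
  · rfl
  · have := h.factorial_ne_zero h1 h2
    exact tripleRatio_zero_left _ (by simp) (this _ (by omega)) (this _ (by omega))
      (this _ hst)
  · simp at h5
  · have h2 : (2 : F) ≠ 0 := fun e => h1 (by linear_combination h4 - e)
    have := h.half_factorial_ne_zero h4 h2
    exact tripleRatio_zero_left (fun n => ((Nat.factorial (n / 2) : ℕ) : F)) (by simp)
      (this _ (by omega)) (this _ (by omega)) (this _ hst)
  · have := h.qPoch_ne_zero h1 h4
    exact tripleRatio_zero_left _ (by simp [qPoch]) (this _ (by omega)) (this _ (by omega))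
      (this _ hst)

theorem IsRecurrent.bracket_zero_mid (h : IsRecurrent d q x) {s t : ℕ} (hst : s + t ≤ d) :
    bracket q s 0 t = 1 := by
  rw [bracket]
  split_ifs with h1 h2 h3 h4 h5
  · exact absurd h3 (by simp)
  · rfl
  · have := h.factorial_ne_zero h1 h2
    exact tripleRatio_zero_mid _ (by simp) (this _ (by omega)) (this _ (by omega))
      (this _ hst)
  · simp at h5
  · have h2 : (2 : F) ≠ 0 := fun e => h1 (by linear_combination h4 - e)
    have := h.half_factorial_ne_zero h4 h2
    exact tripleRatio_zero_mid (fun n => ((Nat.factorial (n / 2) : ℕ) : F)) (by simp)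
      (this _ (by omega)) (this _ (by omega)) (this _ hst)
  · have := h.qPoch_ne_zero h1 h4
    exact tripleRatio_zero_mid _ (by simp [qPoch]) (this _ (by omega)) (this _ (by omega))
      (this _ hst)

/-- This identity is what the row recurrence of the transition matrix demands of the brackets.
Outside characteristic two with `q = 1`, the brackets share a factor by `tripleRatio_steps`, and the
closed form of `x` leaves an explicit identity. -/
theorem IsRecurrent.bracket_rec {r s t : ℕ} (h : IsRecurrent (r + s + t + 2) q x) :
    bracket q (r + 1) (s + 1) t * (x (r + s + t + 2) - x s) =
      (x (s + t + 1) - x (r + s + 1)) * bracket q (r + 1) s (t + 1) +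
        bracket q r (s + 1) (t + 1) * (x (r + s + t + 2) - x s) := by
  by_cases h1 : q = 1
  · by_cases h2 : (2 : F) = 0
    · have hd := h.le_three h1 h2
      simp only [bracket, if_pos h1, if_pos h2]
      -- Since `r + s + t + 2 ≤ 3`, only four triples occur.
      have hcases : r = 0 ∧ s = 0 ∧ t = 0 ∨ r = 1 ∧ s = 0 ∧ t = 0 ∨ r = 0 ∧ s = 1 ∧ t = 0 ∨
        r = 0 ∧ s = 0 ∧ t = 1 := by omega
      rcases hcases with ⟨rfl, rfl, rfl⟩ | ⟨rfl, rfl, rfl⟩ | ⟨rfl, rfl, rfl⟩ | ⟨rfl, rfl, rfl⟩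
      · norm_num
      · have e0 := h.sub_eq 0 (by omega)
        rw [h1] at e0
        norm_num at e0 ⊢
        linear_combination -e0 - 2 * (x 1 - x 2) * h2
      · norm_num
      · have e0 := h.sub_eq 0 (by omega)
        rw [h1] at e0
        norm_num at e0 ⊢
        linear_combination e0 + 2 * (x 1 - x 2) * h2
    · obtain ⟨a, b, c, hx⟩ := h.exists_of_eq_one h1 h2
      obtain ⟨g, g1, g2, g3⟩ := tripleRatio_steps (f := fun n => ((Nat.factorial n : ℕ) : F))
        (h := fun n => (n : F)) (fun n => by rw [Nat.factorial_succ]; push_cast; ring)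
        (h.factorial_ne_zero h1 h2)
      simp only [bracket, if_pos h1, if_neg h2, g1, g2, g3]
      rw [hx _ le_rfl, hx s (by omega), hx (s + t + 1) (by omega), hx (r + s + 1) (by omega)]
      push_cast
      ring
  · by_cases h4 : q = -1
    · have h2 : (2 : F) ≠ 0 := fun e => h1 (by linear_combination h4 - e)
      obtain ⟨a, b, c, hx⟩ := h.exists_of_eq_neg_one h4 h2
      obtain ⟨g, g1, g2, g3⟩ := tripleRatio_steps
        (f := fun n => ((Nat.factorial (n / 2) : ℕ) : F))
        (h := fun n => (if Even n then (n : F) else 2) / 2) (half_factorial_succ h2)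
        (h.half_factorial_ne_zero h4 h2)
      simp only [bracket, if_neg h1, if_pos h4, g1, g2, g3]
      rw [hx _ le_rfl, hx s (by omega), hx (s + t + 1) (by omega), hx (r + s + 1) (by omega)]
      simp only [pow_add, Nat.odd_add_one, Nat.even_add_one, Nat.even_add]
      rcases r.even_or_odd with hr | hr <;> rcases s.even_or_odd with hs | hs <;>
        rcases t.even_or_odd with ht | ht <;>
        rw [hr.neg_one_pow, hs.neg_one_pow, ht.neg_one_pow] <;>
        simp only [← Nat.not_even_iff_odd] at hr hs ht ⊢ <;>
        simp [hr, hs, ht] <;> field_simp <;> ring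
    · obtain ⟨a, b, c, hx⟩ := h.exists_of_ne h1 h4
      obtain ⟨g, g1, g2, g3⟩ := tripleRatio_steps (f := qPoch q) (h := fun n => 1 - q ^ n)
        (qPoch_succ q) (h.qPoch_ne_zero h1 h4)
      simp only [bracket, if_neg h1, if_neg h4, g1, g2, g3]
      rw [hx _ le_rfl, hx s (by omega), hx (s + t + 1) (by omega), hx (r + s + 1) (by omega)]
      have hq := h.ne_zero
      simp only [pow_add, pow_one]
      have hr := pow_ne_zero r hq
      have hs := pow_ne_zero s hq
      have ht := pow_ne_zero t hq
      field_simp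
      ring

end Bracket

end Leonard

namespace Leonard

open Polynomial Matrix

-- Entries of the transition matrix between the two split bases

section Transition

variable {K : Type*} [Field K] {d : ℕ} {T : Matrix (Fin (d + 1)) (Fin (d + 1)) K}
  {θ θs φ ψ : ℕ → K}

theorem prodUp_succ (f : ℕ → K) (i : ℕ) : prodUp f (i + 1) = prodUp f i * f (i + 1) :=
  Finset.prod_range_succ _ _

theorem prodUp_ne_zero (hφ : ∀ i, 1 ≤ i → i ≤ d → φ i ≠ 0) {i : ℕ} (hi : i ≤ d) :
    prodUp φ i ≠ 0 := Finset.prod_ne_zero_iff.2 fun h hh => by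
  rw [Finset.mem_range] at hh
  exact hφ _ (by omega) (by omega)

theorem prodUp_reverse (ϕ : ℕ → K) {j : ℕ} (hj : j ≤ d) :
    prodUp (fun k => ϕ (d - k + 1)) j = prodDown d ϕ j := by
  refine Finset.prod_congr rfl fun h hh => ?_
  rw [Finset.mem_range] at hh
  beta_reduce
  rw [show d - (h + 1) + 1 = d - h by omega]

theorem prodUp_congr {φ φ' : ℕ → K} (h : ∀ i, 1 ≤ i → i ≤ d → φ i = φ' i) {j : ℕ} (hj : j ≤ d) :
    prodUp φ j = prodUp φ' j := by
  refine Finset.prod_congr rfl fun k hk => ?_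
  rw [Finset.mem_range] at hk
  exact h _ (by omega) (by omega)

/-- The row recurrence for a matrix intertwining two upper bidiagonal matrices. -/
theorem transition_rec
    (hU : upperBidiagonal d θs φ * T = T * upperBidiagonal d (fun i => θs (d - i)) ψ)
    {i j k l : Fin (d + 1)} (hk : k.val = i.val + 1) (hj : j.val = l.val + 1) :
    φ k * T k j = (θs (d - j) - θs i) * T i j + ψ j * T i l := by
  have h := upperBidiagonal_mul_of_succ T θs φ i j k hk
  rw [hU, mul_upperBidiagonal_of_succ T _ ψ i j l hj] at h
  linear_combination -h

theorem transition_rec_zero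
    (hU : upperBidiagonal d θs φ * T = T * upperBidiagonal d (fun i => θs (d - i)) ψ)
    {i k : Fin (d + 1)} (hk : k.val = i.val + 1) :
    φ k * T k 0 = (θs d - θs i) * T i 0 := by
  have h := upperBidiagonal_mul_of_succ T θs φ i 0 k hk
  rw [hU, mul_upperBidiagonal_of_eq_zero T _ ψ i 0 rfl] at h
  simp only [Fin.val_zero, Nat.sub_zero] at h
  linear_combination -h

/-- On the diagonal the row recurrence loses its first term by triangularity, so each entry is `ψ_m
/ φ_m` times the previous one. -/
theorem transition_diag (hT : UpperBand 0 T)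
    (hU : upperBidiagonal d θs φ * T = T * upperBidiagonal d (fun i => θs (d - i)) ψ)
    (h0 : T 0 0 = 1) (hφ : ∀ i, 1 ≤ i → i ≤ d → φ i ≠ 0) :
    ∀ (m : ℕ) (i : Fin (d + 1)), i.val = m → T i i = prodUp ψ m / prodUp φ m := by
  intro m
  induction m with
  | zero =>
    intro i hi
    obtain rfl : i = 0 := Fin.ext hi
    simp [prodUp, h0]
  | succ m ih =>
    intro k hk
    have h1 := transition_rec hU (i := ⟨m, by omega⟩) (k := k) (j := k) (l := ⟨m, by omega⟩) hk hk
    rw [hT ⟨m, by omega⟩ k (by simp; omega), mul_zero, zero_add, ih ⟨m, by omega⟩ rfl, hk] at h1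
    have h2 := hφ (m + 1) (by omega) (by omega)
    have h3 := prodUp_ne_zero hφ (show m ≤ d by omega)
    rw [prodUp_succ, prodUp_succ, eq_div_iff (mul_ne_zero h3 h2)]
    field_simp at h1
    linear_combination h1

/-- The entries of a lower triangular matrix intertwining two upper bidiagonal matrices with
mutually reversed recurrent diagonals. -/
theorem transition_apply {F : Type*} [Field F] [Algebra K F] {q : F} (hT : UpperBand 0 T)
    (hU : upperBidiagonal d θs φ * T = T * upperBidiagonal d (fun i => θs (d - i)) ψ)
    (h0 : T 0 0 = 1) (hφ : ∀ i, 1 ≤ i → i ≤ d → φ i ≠ 0)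
    (hq : IsRecurrent d q fun i => algebraMap K F (θs i)) :
    ∀ (m : ℕ) (i j : Fin (d + 1)), i.val = m → j ≤ i →
      algebraMap K F (T i j) = bracket q j.val (i.val - j.val) (d - i.val) *
        algebraMap K F
          (prodUp ψ j.val * (tau θs (i.val - j.val)).eval (θs d) / prodUp φ i.val) := by
  intro m
  induction m with
  | zero =>
    intro i j hi hj
    obtain rfl : i = 0 := Fin.ext hi
    obtain rfl : j = 0 := Fin.ext (by simpa using hj)
    rw [h0]
    simp only [Fin.val_zero, Nat.sub_zero]
    rw [hq.bracket_zero_left (by omega)]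
    simp [prodUp, tau]
  | succ m ih =>
    intro k j hk hj
    rw [Fin.le_def] at hj
    have hφk := hφ (m + 1) (by omega) (by omega)
    have hpm := prodUp_ne_zero hφ (show m ≤ d by omega)
    have hφk' : algebraMap K F (φ (m + 1)) ≠ 0 := by simpa using hφk
    have hpm' : algebraMap K F (prodUp φ m) ≠ 0 := by simpa using hpm
    refine mul_left_cancel₀ hφk' ?_
    rcases Nat.eq_zero_or_pos j.val with hj0 | hj0
    · obtain rfl : j = 0 := Fin.ext hj0
      have h1 := congrArg (algebraMap K F) (transition_rec_zero hU (i := ⟨m, by omega⟩) hk)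
      rw [map_mul, map_mul, ih ⟨m, by omega⟩ 0 rfl (Fin.zero_le _), hk] at h1
      rw [h1]
      simp only [Fin.val_zero, Nat.sub_zero, hk]
      rw [hq.bracket_zero_left (by omega), hq.bracket_zero_left (by omega), prodUp_succ, tau_succ]
      simp only [eval_mul, eval_sub, eval_X, eval_C, map_mul, map_div₀, map_sub]
      field_simp
    · have h1 := congrArg (algebraMap K F) (transition_rec hU (i := ⟨m, by omega⟩) (k := k)
        (j := j) (l := ⟨j.val - 1, by omega⟩) hk (by simp; omega))
      obtain ⟨r, hr⟩ : ∃ r, j.val = r + 1 := ⟨j.val - 1, by omega⟩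
      have hl : (⟨j.val - 1, by omega⟩ : Fin (d + 1)) = ⟨r, by omega⟩ := Fin.ext (by simp; omega)
      rw [hl] at h1
      rw [map_mul, map_add, map_mul, map_mul,
        ih ⟨m, by omega⟩ ⟨r, by omega⟩ rfl (by rw [Fin.le_def]; simp only; omega), hk, hr] at h1
      rw [h1]
      -- Strictly below the diagonal all three terms are present and `bracket_rec` applies with `j =
      -- r + 1`, `k = r + s + 2` and `d = r + s + t + 2`. On the diagonal the entry above vanishes
      -- and both brackets are 1.
      by_cases hjm : r + 1 ≤ m
      · obtain ⟨s, hs⟩ : ∃ s, m = r + s + 1 := ⟨m - r - 1, by omega⟩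
        obtain ⟨t, ht⟩ : ∃ t, d = r + s + t + 2 := ⟨d - (r + s + 2), by omega⟩
        rw [ih ⟨m, by omega⟩ j rfl (by rw [Fin.le_def]; simp only; omega)]
        simp only [hr, hk, hs]
        rw [show r + s + 1 - (r + 1) = s by omega, show r + s + 1 - r = s + 1 by omega,
          show r + s + 1 + 1 - (r + 1) = s + 1 by omega,
          show d - (r + s + 1) = t + 1 by omega, show d - (r + s + 1 + 1) = t by omega,
          show d - (r + 1) = s + t + 1 by omega]
        have hrec : bracket q (r + 1) (s + 1) t * (algebraMap K F (θs d) - algebraMap K F (θs s)) =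
            (algebraMap K F (θs (s + t + 1)) - algebraMap K F (θs (r + s + 1))) *
              bracket q (r + 1) s (t + 1) +
            bracket q r (s + 1) (t + 1) * (algebraMap K F (θs d) - algebraMap K F (θs s)) := by
          rw [ht] at hq ⊢
          exact hq.bracket_rec
        rw [hs] at hφk' hpm'
        rw [prodUp_succ φ (r + s + 1), prodUp_succ ψ, tau_succ]
        simp only [eval_mul, eval_sub, eval_X, eval_C, map_mul, map_div₀, map_sub]
        field_simp
        linear_combination -(algebraMap K F (prodUp ψ r) * algebraMap K F (ψ (r + 1)) *
          algebraMap K F ((tau θs s).eval (θs d))) * hrec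
      · have hrm : r = m := by omega
        subst hrm
        rw [hT ⟨r, by omega⟩ j (by simp; omega)]
        simp only [hr, hk, Nat.sub_self]
        rw [hq.bracket_zero_mid (by omega), hq.bracket_zero_mid (by omega), prodUp_succ φ,
          prodUp_succ ψ]
        simp only [tau, Finset.range_zero, Finset.prod_empty, eval_one, map_mul, map_div₀,
          map_zero, map_one]
        field_simp
        ring

end Transition

-- Existence of a base, and the switching element as a transition matrix

section Switching

variable {K : Type*} [Field K] {d : ℕ}

theorem aeval_lowerBidiagonal_diag (θ : ℕ → K) (p : K[X]) (i : Fin (d + 1)) :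
    (aeval (lowerBidiagonal d θ) p) i i = p.eval (θ i) := by
  have hpow : ∀ k, UpperBand 0 (lowerBidiagonal d θ ^ k) ∧
      (lowerBidiagonal d θ ^ k) i i = θ i ^ k := by
    intro k
    induction k with
    | zero => rw [pow_zero]; exact ⟨upperBand_one, by simp⟩
    | succ k ih =>
      rw [pow_succ]
      refine ⟨ih.1.mul (upperBand_lowerBidiagonal θ), ?_⟩
      rw [ih.1.mul_apply (upperBand_lowerBidiagonal θ) (m := i) rfl rfl, ih.2, pow_succ]
      simp [lowerBidiagonal]
  induction p using Polynomial.induction_on' with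
  | add p q hp hq => rw [map_add, Matrix.add_apply, hp, hq, eval_add]
  | monomial k a =>
    rw [aeval_monomial, ← Algebra.smul_def, Matrix.smul_apply, (hpow k).2, eval_monomial,
      smul_eq_mul]

/-- The equation `q + q⁻¹ + 1 = c⁻¹` becomes `q² + (1 - c⁻¹) q + 1 = 0`, solvable in the algebraic
closure with nonzero roots. Below `d = 3` nothing is required and `q = 1` serves. -/
theorem IsSystem.exists_isBase {Φ : SystemData K (Matrix (Fin (d + 1)) (Fin (d + 1)) K)}
    {P Q : Matrix (Fin (d + 1)) (Fin (d + 1)) K} (h : IsSystem Φ.A Φ.As Φ.θ Φ.θs P Q) :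
    ∃ q, Φ.IsBase d q := by
  by_cases hd : 3 ≤ d
  · obtain ⟨c, hc, hrec⟩ := h.exists_recurrence hd
    obtain ⟨q, hq⟩ := IsAlgClosed.exists_root
      (C 1 * X ^ 2 + C (algebraMap K (AlgebraicClosure K) (1 - c⁻¹)) * X + C 1)
      (by rw [degree_quadratic one_ne_zero]; norm_num)
    have hq' : q ^ 2 + algebraMap K (AlgebraicClosure K) (1 - c⁻¹) * q + 1 = 0 := by
      simpa [IsRoot] using hq
    have hq0 : q ≠ 0 := by
      rintro rfl
      simp at hq'
    have hsum : algebraMap K (AlgebraicClosure K) c⁻¹ = q + q⁻¹ + 1 := by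
      rw [map_sub, map_one] at hq'
      generalize algebraMap K (AlgebraicClosure K) c⁻¹ = b at hq' ⊢
      field_simp
      linear_combination -hq'
    have hne : ∀ {x : ℕ → K} {i : ℕ}, Set.InjOn x (Set.Iic d) → 2 ≤ i → i + 1 ≤ d →
        x (i - 1) - x i = c * (x (i - 2) - x (i + 1)) →
        (x (i - 2) - x (i + 1)) / (x (i - 1) - x i) = c⁻¹ := by
      intro x i hx hi hid hxr
      have : x (i - 1) - x i ≠ 0 := sub_ne_zero.2 fun e => by
        have := hx (Set.mem_Iic.2 (by omega)) (Set.mem_Iic.2 (by omega)) e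
        omega
      rw [div_eq_iff this, hxr, inv_mul_cancel_left₀ hc]
    refine ⟨q, hq0, fun i hi hid => ?_⟩
    obtain ⟨h1, h2⟩ := hrec i hi hid
    rw [hne h.injOn hi hid h1, hne h.injOn_dual hi hid h2, hsum]
    exact ⟨rfl, rfl⟩
  · exact ⟨1, one_ne_zero, fun i hi hid => by omega⟩

theorem SystemData.IsBase.isRecurrent {𝒜 : Type*} [Ring 𝒜] [Algebra K 𝒜] {Φ : SystemData K 𝒜}
    {q : AlgebraicClosure K} (hq : Φ.IsBase d q) (hθs : Set.InjOn Φ.θs (Set.Iic d)) :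
    IsRecurrent d q fun i => algebraMap K (AlgebraicClosure K) (Φ.θs i) := by
  refine ⟨hq.1, fun i hi j hj hij => hθs hi hj ((algebraMap K _).injective hij), ?_⟩
  intro k hk
  have h1 := (hq.2 (k + 2) (by omega) (by omega)).2
  rw [show k + 2 - 2 = k by omega, show k + 2 - 1 = k + 1 by omega] at h1
  have hne : Φ.θs (k + 1) - Φ.θs (k + 2) ≠ 0 := sub_ne_zero.2 fun e => by
    have := hθs (Set.mem_Iic.2 (by omega)) (Set.mem_Iic.2 (by omega)) e
    omega
  have hne' : algebraMap K (AlgebraicClosure K) (Φ.θs (k + 1) - Φ.θs (k + 2)) ≠ 0 :=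
    (_root_.map_ne_zero _).2 hne
  rw [map_div₀, div_eq_iff hne', map_sub, map_sub] at h1
  exact h1

/-- The switching element of a system of matrices, in the split basis. -/
theorem IsSystem.switching {Φ : SystemData K (Matrix (Fin (d + 1)) (Fin (d + 1)) K)}
    {P Q : Matrix (Fin (d + 1)) (Fin (d + 1)) K} (h : IsSystem Φ.A Φ.As Φ.θ Φ.θs P Q) :
    IsUnit (Φ.switching d AlgEquiv.refl) ∧
    ∀ q, Φ.IsBase d q →
      HasSwitchingEntries d Φ.θs (Φ.firstSplit d AlgEquiv.refl) (Φ.secondSplit d AlgEquiv.refl) q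
        ((tauColumns Φ.A Φ.θ (Q.col 0))⁻¹ * Φ.switching d AlgEquiv.refl *
          tauColumns Φ.A Φ.θ (Q.col 0)) ∧
      HasInverseSwitchingEntries d Φ.θs (Φ.firstSplit d AlgEquiv.refl)
        (Φ.secondSplit d AlgEquiv.refl) q
        ((tauColumns Φ.A Φ.θ (Q.col 0))⁻¹ * (Φ.switching d AlgEquiv.refl)⁻¹ *
          tauColumns Φ.A Φ.θ (Q.col 0)) := by
  obtain ⟨hWu, hAW, hBW, hφ⟩ := h.splitSequence_spec
  obtain ⟨⟨H, hHu, hAH, hBH⟩, hϕ⟩ := h.exists_reversed_split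
  have eφ : splitSequence d Φ.A Φ.As Φ.θ Φ.θs = Φ.firstSplit d AlgEquiv.refl := rfl
  have eϕ : splitSequence d Φ.A Φ.As (fun i => Φ.θ (d - i)) Φ.θs =
    Φ.secondSplit d AlgEquiv.refl := rfl
  rw [eφ] at hBW hφ
  rw [eϕ] at hBH hϕ
  set W := tauColumns Φ.A Φ.θ (Q.col 0)
  set φ := Φ.firstSplit d AlgEquiv.refl with hφdef
  set ϕ := Φ.secondSplit d AlgEquiv.refl with hϕdef
  set S := Φ.switching d AlgEquiv.refl with hS
  set L := lowerBidiagonal d Φ.θ with hL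
  have hWd := (Matrix.isUnit_iff_isUnit_det W).1 hWu
  have hWinv : W⁻¹ * W = 1 := Matrix.nonsing_inv_mul W hWd
  have hWiu : IsUnit W⁻¹ := by
    rw [Matrix.isUnit_iff_isUnit_det]; exact W.isUnit_nonsing_inv_det hWd
  have inter : ∀ {X Y Z : Matrix (Fin (d + 1)) (Fin (d + 1)) K}, X * W = W * Y →
      X * H = H * Z → Y * (W⁻¹ * H) = W⁻¹ * H * Z := by
    intro X Y Z h1 h2
    rw [← Matrix.mul_assoc, ← inv_mul_eq_of_mul_eq hWu h1, Matrix.mul_assoc, h2,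
      Matrix.mul_assoc]
  have hLT₀ := inter hAW hAH
  have hUT₀ := inter hBW hBH
  have hT₀u : IsUnit (W⁻¹ * H) := hWiu.mul hHu
  have hc := (upperBand_of_commute_lowerBidiagonal h.injOn hLT₀).apply_self_ne_zero hT₀u 0
  -- The scaling makes the corner entry 1, which is the coefficient of `E_0` in the switching
  -- element.
  obtain ⟨T, hT⟩ : ∃ T, T = ((W⁻¹ * H) 0 0)⁻¹ • (W⁻¹ * H) := ⟨_, rfl⟩
  have hLT : L * T = T * L := by rw [hT, mul_smul_comm, smul_mul_assoc, hLT₀]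
  have hUT : upperBidiagonal d Φ.θs φ * T = T * upperBidiagonal d (fun i => Φ.θs (d - i))
      (fun k => ϕ (d - k + 1)) := by rw [hT, mul_smul_comm, smul_mul_assoc, hUT₀]
  have hT00 : T 0 0 = 1 := by
    rw [hT, Matrix.smul_apply, smul_eq_mul, inv_mul_cancel₀ hc]
  have hTb := upperBand_of_commute_lowerBidiagonal h.injOn hLT
  have hψ : ∀ i, 1 ≤ i → i ≤ d → ϕ (d - i + 1) ≠ 0 := fun i h1 h2 =>
    hϕ _ (by omega) (by omega)
  have hdiag : ∀ i : Fin (d + 1), T i i = prodDown d ϕ i / prodUp φ i := fun i => by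
    rw [transition_diag hTb hUT hT00 hφ i i rfl, prodUp_reverse ϕ (by omega)]
  have hTu : IsUnit T := hTb.isUnit fun i => by
    rw [hdiag, ← prodUp_reverse ϕ (by omega)]
    exact div_ne_zero (prodUp_ne_zero hψ (by omega)) (prodUp_ne_zero hφ (by omega))
  have hTd := (Matrix.isUnit_iff_isUnit_det T).1 hTu
  -- the switching element in the split basis commutes with `L` and has the same diagonal as `T`
  obtain ⟨p, hp, hpe⟩ : ∃ p : K[X], S = aeval Φ.A p ∧ ∀ i : Fin (d + 1),
      p.eval (Φ.θ i) = prodDown d ϕ i / prodUp φ i := by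
    refine ⟨∑ r ∈ Finset.range (d + 1), (prodDown d ϕ r / prodUp φ r) •
      ∏ k ∈ (Finset.range (d + 1)).erase r, (C (Φ.θ r - Φ.θ k)⁻¹ * (X - C (Φ.θ k))), ?_, ?_⟩
    · rw [map_sum, hS, SystemData.switching]
      refine Finset.sum_congr rfl fun r _ => ?_
      rw [map_smul]
      rfl
    · intro i
      rw [eval_finsetSum, Finset.sum_eq_single i.val]
      · rw [eval_smul, eval_primitiveIdempotent h.injOn (by omega) (by omega), if_pos rfl,
          smul_eq_mul, mul_one]
      · intro r hr hri
        rw [Finset.mem_range] at hr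
        rw [eval_smul, eval_primitiveIdempotent h.injOn (by omega) (by omega),
          if_neg (Ne.symm hri), smul_zero]
      · intro hi
        exact absurd (Finset.mem_range.2 i.isLt) hi
  have hSW : S * W = W * aeval L p := by rw [hp]; exact aeval_mul_eq_mul_aeval hAW p
  have hpT : aeval L p = T := by
    refine ext_of_commute_lowerBidiagonal h.injOn ?_ hLT fun i => ?_
    · have := aeval_mul_eq_mul_aeval (rfl : L * L = L * L) p
      exact this.symm
    · rw [aeval_lowerBidiagonal_diag, hpe, hdiag]
  rw [hpT] at hSW
  have hSeq : S = W * T * W⁻¹ := by rw [← hSW, Matrix.mul_nonsing_inv_cancel_right _ _ hWd]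
  have hS1 : W⁻¹ * S * W = T := by
    rw [Matrix.mul_assoc, hSW, Matrix.nonsing_inv_mul_cancel_left _ _ hWd]
  have hS2 : W⁻¹ * S⁻¹ * W = T⁻¹ := by
    rw [hSeq, Matrix.mul_inv_rev, Matrix.mul_inv_rev, Matrix.nonsing_inv_nonsing_inv _ hWd,
      Matrix.nonsing_inv_mul_cancel_left _ _ hWd, Matrix.mul_assoc, hWinv, mul_one]
  refine ⟨by rw [hSeq]; exact (hWu.mul hTu).mul hWiu, fun q hq => ?_⟩
  have hrec := hq.isRecurrent h.injOn_dual
  rw [hS1, hS2]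
  have hTib := hTb.inv hTu
  have hTi00 : T⁻¹ 0 0 = 1 := by
    have h1 := hTb.mul_apply hTib (i := 0) (m := 0) (j := 0) rfl rfl
    rw [Matrix.mul_nonsing_inv _ hTd, hT00, one_mul, one_apply_eq] at h1
    exact h1.symm
  -- Inverting swaps the two upper bidiagonal matrices. The diagonal is written as a double reversal
  -- to fit `transition_apply` with `θs` reversed.
  have hUTi : upperBidiagonal d (fun i => Φ.θs (d - i)) (fun k => ϕ (d - k + 1)) * T⁻¹ =
      T⁻¹ * upperBidiagonal d (fun i => Φ.θs (d - (d - i))) φ := by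
    rw [← inv_mul_eq_of_mul_eq hTu hUT]
    congr 1
    ext i j
    simp only [upperBidiagonal, of_apply, show d - (d - i.val) = i.val by omega]
  refine ⟨⟨fun i j hij => hTb i j (by rw [Fin.lt_def] at hij; omega), fun i j hij => ?_⟩,
    ⟨fun i j hij => hTib i j (by rw [Fin.lt_def] at hij; omega), fun i j hij => ?_⟩⟩
  · rw [transition_apply hTb hUT hT00 hφ hrec i i j rfl hij, prodUp_reverse ϕ (by omega)]
  -- For the reversed sequence `τ^*` is definitionally `η^*`, and its value at index `d` is `θs 0`.
  · rw [transition_apply (θs := fun i => Φ.θs (d - i)) hTib hUTi hTi00 hψ hrec.reverse i i j rfl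
      hij, prodUp_reverse ϕ (by omega), Nat.sub_self]
    rfl

end Switching

-- Leonard systems in terms of idempotents and of eigenbases

section LeonardSystem

variable {K : Type*} [Field K] {d : ℕ}
  {A B P Q : Matrix (Fin (d + 1)) (Fin (d + 1)) K} {θ θs : ℕ → K}

theorem IsEigenvalueOrdering.exists_eigenbasis (h : IsEigenvalueOrdering d A θ) :
    ∃ P : Matrix (Fin (d + 1)) (Fin (d + 1)) K, IsUnit P ∧
      A * P = P * diagonal fun i : Fin (d + 1) => θ i := by
  have hev : ∀ i : Fin (d + 1), ∃ x, Module.End.HasEigenvector (toLin' A) (θ i) x := by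
    intro i
    have h1 : θ i ∈ spectrum K A := by
      rw [h.2]; exact ⟨i, Set.mem_Iic.2 (by omega), rfl⟩
    rw [← spectrum_toLin'] at h1
    exact (Module.End.HasEigenvalue.of_mem_spectrum h1).exists_hasEigenvector
  choose x hx using hev
  have hinj : Function.Injective fun i : Fin (d + 1) => θ i := fun i j hij =>
    Fin.ext (h.1 (Set.mem_Iic.2 (by omega)) (Set.mem_Iic.2 (by omega)) hij)
  have hli := Module.End.eigenvectors_linearIndependent' (toLin' A) _ hinj x hx
  refine ⟨Matrix.of fun i j => x j i, ?_, ?_⟩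
  · rw [← Matrix.linearIndependent_cols_iff_isUnit]
    exact hli
  · ext i j
    have := congrFun (hx j).apply_eq_smul i
    rw [toLin'_apply] at this
    rw [mul_diagonal, Matrix.mul_apply]
    simpa [mulVec, dotProduct, mul_comm] using this

theorem isEigenvalueOrdering_of_mul_eq (hθ : Set.InjOn θ (Set.Iic d)) (hP : IsUnit P)
    (h : A * P = P * diagonal fun i : Fin (d + 1) => θ i) : IsEigenvalueOrdering d A θ := by
  refine ⟨hθ, ?_⟩
  obtain ⟨u, rfl⟩ := hP
  have : A = u * (diagonal fun i : Fin (d + 1) => θ i) * (u⁻¹ : (Matrix _ _ K)ˣ) := by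
    rw [← h, Units.mul_inv_cancel_right]
  rw [this, spectrum.units_conjugate, spectrum_diagonal]
  ext z
  constructor
  · rintro ⟨i, rfl⟩
    exact ⟨i, Set.mem_Iic.2 (by omega), rfl⟩
  · rintro ⟨i, hi, rfl⟩
    exact ⟨⟨i, by rw [Set.mem_Iic] at hi; omega⟩, rfl⟩

/-- In the eigenbasis the idempotents cut out one entry of the matrix of `B`, so the axioms of a
Leonard system become irreducible tridiagonality. -/
theorem primitiveIdempotent_mul_mul_eq_zero_iff (hθ : Set.InjOn θ (Set.Iic d)) (hP : IsUnit P)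
    (h : A * P = P * diagonal fun i : Fin (d + 1) => θ i) (i j : Fin (d + 1)) :
    primitiveIdempotent d A θ i * B * primitiveIdempotent d A θ j = 0 ↔
      (P⁻¹ * B * P) i j = 0 := by
  have hPd := (Matrix.isUnit_iff_isUnit_det P).1 hP
  have h1 : primitiveIdempotent d A θ i * B * primitiveIdempotent d A θ j * P =
      P * (diagonal (Pi.single i 1) * (P⁻¹ * B * P) * diagonal (Pi.single j 1)) := by
    rw [← Matrix.mul_assoc P, ← Matrix.mul_assoc P, ← primitiveIdempotent_mul hθ h]
    simp only [Matrix.mul_assoc]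
    rw [primitiveIdempotent_mul hθ h, Matrix.mul_nonsing_inv_cancel_left _ _ hPd]
  have h2 : diagonal (Pi.single i 1) * (P⁻¹ * B * P) * diagonal (Pi.single j 1) =
      Matrix.single i j ((P⁻¹ * B * P) i j) := by
    ext a b
    rw [mul_diagonal, diagonal_mul]
    by_cases ha : i = a
    · by_cases hb : j = b
      · subst ha hb; simp
      · simp [Ne.symm hb, hb]
    · simp [Ne.symm ha, ha]
  rw [h2] at h1
  constructor
  · intro h3
    rw [h3, Matrix.zero_mul] at h1
    have h4 := congrArg (P⁻¹ * ·) h1.symm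
    simp only [Matrix.nonsing_inv_mul_cancel_left _ _ hPd, Matrix.mul_zero] at h4
    simpa using congrFun (congrFun h4 i) j
  · intro h3
    rw [h3, Matrix.single_zero, Matrix.mul_zero] at h1
    have h4 := congrArg (· * P⁻¹) h1
    simpa only [Matrix.mul_nonsing_inv_cancel_right _ _ hPd, Matrix.zero_mul] using h4

theorem isLeonardSystem_iff (Φ : SystemData K (Matrix (Fin (d + 1)) (Fin (d + 1)) K)) :
    Φ.IsLeonardSystem d ↔ ∃ P Q, IsSystem Φ.A Φ.As Φ.θ Φ.θs P Q := by
  constructor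
  · intro h
    obtain ⟨P, hP, hAP⟩ := h.ordering.exists_eigenbasis
    obtain ⟨Q, hQ, hBQ⟩ := h.ordering_dual.exists_eigenbasis
    refine ⟨P, Q, h.ordering.1, h.ordering_dual.1, ⟨hP, hAP, ⟨fun i j hij => ?_, fun i j hij => ?_⟩⟩,
      ⟨hQ, hBQ, ⟨fun i j hij => ?_, fun i j hij => ?_⟩⟩⟩
    · rw [← primitiveIdempotent_mul_mul_eq_zero_iff h.ordering.1 hP hAP]
      exact h.dual_zero i j (by omega) (by omega) hij
    · rw [Ne, ← primitiveIdempotent_mul_mul_eq_zero_iff h.ordering.1 hP hAP]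
      exact h.dual_ne_zero i j (by omega) (by omega) hij
    · rw [← primitiveIdempotent_mul_mul_eq_zero_iff h.ordering_dual.1 hQ hBQ]
      exact h.zero i j (by omega) (by omega) hij
    · rw [Ne, ← primitiveIdempotent_mul_mul_eq_zero_iff h.ordering_dual.1 hQ hBQ]
      exact h.ne_zero i j (by omega) (by omega) hij
  · rintro ⟨P, Q, h⟩
    have h1 := primitiveIdempotent_mul_mul_eq_zero_iff (B := Φ.As) h.injOn h.left.isUnit
      h.left.mul_eq
    have h2 := primitiveIdempotent_mul_mul_eq_zero_iff (B := Φ.A) h.injOn_dual h.right.isUnit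
      h.right.mul_eq
    refine ⟨isEigenvalueOrdering_of_mul_eq h.injOn h.left.isUnit h.left.mul_eq,
      isEigenvalueOrdering_of_mul_eq h.injOn_dual h.right.isUnit h.right.mul_eq,
      fun i j hi hj hij => ?_, fun i j hi hj hij => ?_, fun i j hi hj hij => ?_,
      fun i j hi hj hij => ?_⟩
    · exact (h1 ⟨i, by omega⟩ ⟨j, by omega⟩).2 (h.left.tridiagonal.1 _ _ hij)
    · exact fun e => h.left.tridiagonal.2 _ _ hij ((h1 ⟨i, by omega⟩ ⟨j, by omega⟩).1 e)
    · exact (h2 ⟨i, by omega⟩ ⟨j, by omega⟩).2 (h.right.tridiagonal.1 _ _ hij)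
    · exact fun e => h.right.tridiagonal.2 _ _ hij ((h2 ⟨i, by omega⟩ ⟨j, by omega⟩).1 e)

end LeonardSystem

-- Bases as invertible matrices

section ColumnBasis

variable {K : Type*} [Field K] {n : ℕ}

theorem mul_inv_of_isUnit {W : Matrix (Fin n) (Fin n) K} (hW : IsUnit W) : W * W⁻¹ = 1 :=
  Matrix.mul_nonsing_inv W ((Matrix.isUnit_iff_isUnit_det W).1 hW)

theorem inv_mul_of_isUnit {W : Matrix (Fin n) (Fin n) K} (hW : IsUnit W) : W⁻¹ * W = 1 :=
  Matrix.nonsing_inv_mul W ((Matrix.isUnit_iff_isUnit_det W).1 hW)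

/-- The basis formed by the columns of an invertible matrix. -/
noncomputable def columnBasis (W : Matrix (Fin n) (Fin n) K) (hW : IsUnit W) :
    Module.Basis (Fin n) K (Fin n → K) :=
  Module.Basis.ofEquivFun
    (Matrix.toLin'OfInv (inv_mul_of_isUnit hW) (mul_inv_of_isUnit hW)).symm

theorem columnBasis_apply (W : Matrix (Fin n) (Fin n) K) (hW : IsUnit W) (j : Fin n) :
    columnBasis W hW j = W.col j := by
  rw [columnBasis, Module.Basis.coe_ofEquivFun]
  simp [Matrix.toLin'OfInv]

theorem columnBasis_repr (W : Matrix (Fin n) (Fin n) K) (hW : IsUnit W) (y : Fin n → K)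
    (i : Fin n) : (columnBasis W hW).repr y i = (W⁻¹ *ᵥ y) i := by
  rfl

theorem toMatrix_columnBasis (W : Matrix (Fin n) (Fin n) K) (hW : IsUnit W)
    (A : Matrix (Fin n) (Fin n) K) :
    LinearMap.toMatrix (columnBasis W hW) (columnBasis W hW) (toLin' A) = W⁻¹ * A * W := by
  ext i j
  rw [LinearMap.toMatrix_apply, columnBasis_repr, columnBasis_apply, toLin'_apply,
    mulVec_mulVec]
  rfl

theorem exists_columnBasis (b : Module.Basis (Fin n) K (Fin n → K)) :
    ∃ (W : Matrix (Fin n) (Fin n) K) (hW : IsUnit W), b = columnBasis W hW := by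
  have hW : IsUnit (Matrix.of fun i j => b j i : Matrix (Fin n) (Fin n) K) := by
    rw [← Matrix.linearIndependent_cols_iff_isUnit]
    exact b.linearIndependent
  refine ⟨_, hW, Module.Basis.eq_of_apply_eq fun j => ?_⟩
  rw [columnBasis_apply]
  rfl

end ColumnBasis

-- From Leonard pairs to Leonard systems: ordering the eigenbases

section LeonardPair

variable {K : Type*} [Field K] {d : ℕ}

/-- A self-avoiding walk with unit steps on an integer interval is monotone. -/
theorem eq_add_mul_of_unit_steps {d : ℕ} {s : ℕ → ℤ} (hinj : Set.InjOn s (Set.Iic d))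
    (hs : ∀ i, i + 1 ≤ d → s (i + 1) - s i = 1 ∨ s (i + 1) - s i = -1) :
    ∃ ε : ℤ, (ε = 1 ∨ ε = -1) ∧ ∀ i, i ≤ d → s i = s 0 + ε * i := by
  rcases Nat.eq_zero_or_pos d with rfl | hd
  · exact ⟨1, Or.inl rfl, fun i hi => by obtain rfl : i = 0 := by omega
                                         simp⟩
  refine ⟨s 1 - s 0, hs 0 hd, ?_⟩
  have step : ∀ i, i + 1 ≤ d → s (i + 1) - s i = s 1 - s 0 := by
    intro i
    induction i with
    | zero => intro _; rfl
    | succ i ih =>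
      intro hi
      rw [← ih (by omega)]
      have hne : s (i + 1 + 1) ≠ s i := fun e => by
        have := hinj (Set.mem_Iic.2 hi) (Set.mem_Iic.2 (by omega)) e
        omega
      -- A change of direction would return to the value two steps earlier.
      rcases hs i (by omega) with h1 | h1 <;> rcases hs (i + 1) hi with h2 | h2 <;> omega
  intro i
  induction i with
  | zero => intro _; simp
  | succ i ih =>
    intro hi
    have h1 := step i hi
    have h2 := ih (by omega)
    push_cast
    linear_combination h1 + h2

/-- The eigenvector matrix of a lower triangular matrix is lower triangular. -/
theorem UpperBand.of_mul_eq_mul_diagonal {B V : Matrix (Fin (d + 1)) (Fin (d + 1)) K} {θ : ℕ → K}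
    (hθ : Set.InjOn θ (Set.Iic d)) (hB : UpperBand 0 B) (hBd : ∀ i, B i i = θ i)
    (h : B * V = V * diagonal fun i : Fin (d + 1) => θ i) : UpperBand 0 V := by
  have key : ∀ m : ℕ, ∀ i j : Fin (d + 1), i.val = m → i < j → V i j = 0 := by
    intro m
    induction m using Nat.strong_induction_on with
    | _ m ih =>
      intro i j hi hij
      have h1 := congrFun (congrFun h i) j
      rw [mul_diagonal, Matrix.mul_apply, Finset.sum_eq_single i, hBd] at h1
      · have hne : θ i - θ j ≠ 0 := sub_ne_zero.2 fun e => hij.ne (Fin.ext (hθ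
          (Set.mem_Iic.2 (by omega)) (Set.mem_Iic.2 (by omega)) e))
        exact (mul_eq_zero.1 (by linear_combination h1 : (θ i - θ j) * V i j = 0)).resolve_left
          hne
      · intro k _ hki
        rcases lt_or_gt_of_ne hki with hlt | hlt
        · rw [ih k (by rw [Fin.lt_def] at hlt; omega) k j rfl (hlt.trans hij), mul_zero]
        · rw [hB i k (by rw [Fin.lt_def] at hlt; omega), zero_mul]
      · simp
  exact fun i j hij => key _ i j rfl (by rw [Fin.lt_def]; omega)

/-- An eigenbasis of a triangular matrix `B` on which `A` is irreducible tridiagonal can be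
ordered like the diagonal of `B`. -/
theorem exists_isTridiagonalizedBy {A B Q : Matrix (Fin (d + 1)) (Fin (d + 1)) K} {θ : ℕ → K}
    (hθ : Set.InjOn θ (Set.Iic d)) (hB : UpperBand 0 B) (hBd : ∀ i, B i i = θ i)
    (hA : UpperBand 1 A) (hAs : ∀ i j : Fin (d + 1), j.val = i.val + 1 → A i j ≠ 0)
    (hQ : IsUnit Q) (hQA : IsIrredTridiagonal (Q⁻¹ * A * Q)) (hQB : (Q⁻¹ * B * Q).IsDiag) :
    ∃ V, IsTridiagonalizedBy B A V θ := by
  have hQd := (Matrix.isUnit_iff_isUnit_det Q).1 hQ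
  obtain ⟨δ, hδ⟩ : ∃ δ : Fin (d + 1) → K, Q⁻¹ * B * Q = diagonal δ :=
    ⟨_, hQB.diagonal_diag.symm⟩
  have hBQ : B * Q = Q * diagonal δ := by
    rw [← hδ, Matrix.mul_assoc, Matrix.mul_nonsing_inv_cancel_left _ _ hQd]
  -- `B - θ_i` is triangular with a zero on its diagonal; comparing determinants with its
  -- diagonalized form shows that `θ_i` is some `δ_k`.
  have hex : ∀ i : Fin (d + 1), ∃ k, δ k = θ i := by
    intro i
    have h1 : (B - diagonal fun _ => θ i).det = 0 := by
      have hb : UpperBand 0 (B - diagonal fun _ => θ i) := fun a b hab => by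
        rw [Matrix.sub_apply, hB a b hab, upperBand_diagonal _ a b hab, sub_zero]
      rw [det_of_isLowerTriangular _ hb.blockTriangular]
      exact Finset.prod_eq_zero (Finset.mem_univ i) (by simp [hBd])
    have h2 : (B - diagonal fun _ => θ i) * Q = Q * diagonal (fun k => δ k - θ i) := by
      have : diagonal (fun k => δ k - θ i) = diagonal δ - diagonal (fun _ => θ i) :=
        (diagonal_sub _ _).symm
      rw [this, Matrix.sub_mul, Matrix.mul_sub, hBQ]
      congr 1
      ext a b
      rw [diagonal_mul, mul_diagonal, mul_comm]
    have h3 := congrArg det h2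
    rw [det_mul, det_mul, h1, zero_mul, det_diagonal] at h3
    obtain ⟨k, -, hk⟩ := Finset.prod_eq_zero_iff.1
      ((mul_eq_zero.1 h3.symm).resolve_left hQd.ne_zero)
    exact ⟨k, sub_eq_zero.1 hk⟩
  choose σ hσ using hex
  have hσinj : Function.Injective σ := fun i j hij => by
    have : θ i = θ j := by rw [← hσ, ← hσ, hij]
    exact Fin.ext (hθ (Set.mem_Iic.2 (by omega)) (Set.mem_Iic.2 (by omega)) this)
  let π : Equiv.Perm (Fin (d + 1)) := Equiv.ofBijective σ (Finite.injective_iff_bijective.1 hσinj)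
  have hπ : ∀ i, π i = σ i := fun i => rfl
  set V := Q.submatrix id π with hV
  have hVinv : V⁻¹ = Q⁻¹.submatrix π id := by
    have := Matrix.inv_submatrix_equiv Q (Equiv.refl _) π
    simpa using this
  have hVu : IsUnit V := (Matrix.isUnit_submatrix_equiv (Equiv.refl _) π).2 hQ
  have hBV : B * V = V * diagonal fun i : Fin (d + 1) => θ i := by
    ext i j
    have := congrFun (congrFun hBQ i) (π j)
    rw [mul_diagonal, hπ, hσ] at this
    rw [mul_diagonal, ← hπ] at *
    simpa [Matrix.mul_apply, hV] using this
  have hN : V⁻¹ * A * V = (Q⁻¹ * A * Q).submatrix π π := by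
    rw [hVinv]
    ext i j
    simp [Matrix.mul_apply, hV]
  have hVb := UpperBand.of_mul_eq_mul_diagonal hθ hB hBd hBV
  -- `V` is lower triangular, so on the first superdiagonal the conjugated matrix is that of `A`
  -- times nonzero diagonal entries. Since it is also a permuted tridiagonal matrix, `π` takes
  -- neighbours to neighbours.
  have hstep : ∀ i j : Fin (d + 1), j.val = i.val + 1 → (V⁻¹ * A * V) i j ≠ 0 := by
    intro i j hij
    rw [((hVb.inv hVu).mul hA).mul_apply hVb (m := j) (by omega) rfl,
      (hVb.inv hVu).mul_apply hA (m := i) rfl hij]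
    exact mul_ne_zero (mul_ne_zero ((hVb.inv hVu).apply_self_ne_zero
      ((Matrix.isUnit_nonsing_inv_iff).2 hVu) i) (hAs i j hij)) (hVb.apply_self_ne_zero hVu j)
  obtain ⟨ε, hε, hmono⟩ := eq_add_mul_of_unit_steps (d := d)
    (s := fun i => if h : i < d + 1 then ((π ⟨i, h⟩).val : ℤ) else 0)
    (by
      intro i hi j hj hij
      rw [Set.mem_Iic] at hi hj
      simp only [dif_pos (Nat.lt_succ_of_le hi), dif_pos (Nat.lt_succ_of_le hj), Nat.cast_inj]
        at hij
      simpa using π.injective (Fin.ext hij))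
    (by
      intro i hi
      simp only [dif_pos (show i < d + 1 by omega), dif_pos (show i + 1 < d + 1 by omega)]
      have h1 := hstep ⟨i, by omega⟩ ⟨i + 1, by omega⟩ rfl
      rw [hN, submatrix_apply] at h1
      have h2 := mt (hQA.1 (π ⟨i, by omega⟩) (π ⟨i + 1, by omega⟩)) h1
      have h3 : (π ⟨i, by omega⟩).val ≠ (π ⟨i + 1, by omega⟩).val := fun e => by
        simpa using π.injective (Fin.ext e)
      omega)
  have hmono' : ∀ i : Fin (d + 1), ((π i).val : ℤ) = (π 0).val + ε * i.val := by
    intro i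
    have := hmono i (by omega)
    simpa [i.is_le] using this
  refine ⟨V, hVu, hBV, ?_⟩
  rw [hN]
  refine ⟨fun i j hij => hQA.1 _ _ ?_, fun i j hij => hQA.2 _ _ ?_⟩
  · have h1 := hmono' i
    have h2 := hmono' j
    rcases hε with rfl | rfl <;> omega
  · have h1 := hmono' i
    have h2 := hmono' j
    rcases hε with rfl | rfl <;> omega

theorem isLeonardPair_iff (A B : Matrix (Fin (d + 1)) (Fin (d + 1)) K) :
    IsLeonardPair d (toLin' A) (toLin' B) ↔
      (∃ Q : Matrix (Fin (d + 1)) (Fin (d + 1)) K, IsUnit Q ∧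
        IsIrredTridiagonal (Q⁻¹ * A * Q) ∧ (Q⁻¹ * B * Q).IsDiag) ∧
      ∃ P : Matrix (Fin (d + 1)) (Fin (d + 1)) K, IsUnit P ∧
        IsIrredTridiagonal (P⁻¹ * B * P) ∧ (P⁻¹ * A * P).IsDiag := by
  constructor
  · rintro ⟨⟨b, hb1, hb2⟩, ⟨c, hc1, hc2⟩⟩
    obtain ⟨Q, hQ, rfl⟩ := exists_columnBasis b
    obtain ⟨P, hP, rfl⟩ := exists_columnBasis c
    rw [toMatrix_columnBasis] at hb1 hb2 hc1 hc2
    exact ⟨⟨Q, hQ, hb1, hb2⟩, ⟨P, hP, hc1, hc2⟩⟩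
  · rintro ⟨⟨Q, hQ, hb1, hb2⟩, ⟨P, hP, hc1, hc2⟩⟩
    refine ⟨⟨columnBasis Q hQ, ?_⟩, ⟨columnBasis P hP, ?_⟩⟩
    · rw [toMatrix_columnBasis, toMatrix_columnBasis]; exact ⟨hb1, hb2⟩
    · rw [toMatrix_columnBasis, toMatrix_columnBasis]; exact ⟨hc1, hc2⟩

theorem upperBand_transpose_upperBidiagonal (θs φ : ℕ → K) :
    UpperBand 0 (upperBidiagonal d θs φ)ᵀ := by
  intro i j h
  have h1 : j ≠ i := by rintro rfl; omega
  have h2 : ¬ i.val = j.val + 1 := by omega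
  simp [upperBidiagonal, h1, h2]

/-- A Leonard pair supplies unordered eigenbases, which `exists_isTridiagonalizedBy` orders. That
lemma wants a lower triangular matrix to diagonalize, so for the upper bidiagonal one it is applied
to the transposed pair. -/
theorem isLeonardPair_bidiagonal_iff {θ θs φ : ℕ → K} (hθ : Set.InjOn θ (Set.Iic d))
    (hθs : Set.InjOn θs (Set.Iic d)) (hφ : ∀ i, 1 ≤ i → i ≤ d → φ i ≠ 0) :
    IsLeonardPair d (toLin' (lowerBidiagonal d θ)) (toLin' (upperBidiagonal d θs φ)) ↔
      (bidiagonalData d θ θs φ).IsLeonardSystem d := by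
  rw [isLeonardPair_iff, isLeonardSystem_iff]
  constructor
  · rintro ⟨⟨Q, hQ, hQA, hQB⟩, ⟨P, hP, hPB, hPA⟩⟩
    obtain ⟨P', hP'⟩ : ∃ V, IsTridiagonalizedBy (lowerBidiagonal d θ)
        (upperBidiagonal d θs φ) V θ := by
      refine exists_isTridiagonalizedBy hθ (upperBand_lowerBidiagonal θ)
        (fun i => by simp [lowerBidiagonal]) ?_ ?_ hP hPB hPA
      · intro i j h
        have h1 : i ≠ j := by rintro rfl; omega
        have h2 : ¬ j.val = i.val + 1 := by omega
        simp [upperBidiagonal, h1, h2]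
      · intro i j h
        have h1 : i ≠ j := by rintro rfl; omega
        simpa [upperBidiagonal, h1, h] using hφ (i + 1) (by omega) (by omega)
    obtain ⟨Q', hQ'⟩ : ∃ V, IsTridiagonalizedBy (upperBidiagonal d θs φ)ᵀ
        (lowerBidiagonal d θ)ᵀ V θs := by
      have hQd := (Matrix.isUnit_iff_isUnit_det Q).1 hQ
      have hinv : ∀ X : Matrix (Fin (d + 1)) (Fin (d + 1)) K,
          Q⁻¹ᵀ⁻¹ * Xᵀ * Q⁻¹ᵀ = (Q⁻¹ * X * Q)ᵀ := by
        intro X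
        rw [← transpose_nonsing_inv, Matrix.nonsing_inv_nonsing_inv Q hQd]
        simp only [transpose_mul, Matrix.mul_assoc]
      refine exists_isTridiagonalizedBy (Q := Q⁻¹ᵀ) hθs (upperBand_transpose_upperBidiagonal θs φ)
        (fun i => by simp [upperBidiagonal]) ?_ ?_ ?_ ?_ ?_
      · intro i j h
        have h1 : j ≠ i := by rintro rfl; omega
        have h2 : ¬ j.val = i.val + 1 := by omega
        simp [lowerBidiagonal, h1, h2]
      · intro i j h
        have h1 : j ≠ i := by rintro rfl; omega
        simp [lowerBidiagonal, h1, h]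
      · rw [Matrix.isUnit_iff_isUnit_det, det_transpose]
        exact Q.isUnit_nonsing_inv_det hQd
      · rw [hinv]; exact hQA.transpose
      · rw [hinv]; exact hQB.transpose
    have hQ'' := hQ'.transpose
    rw [transpose_transpose, transpose_transpose] at hQ''
    exact ⟨P', Q'⁻¹ᵀ, hθ, hθs, hP', hQ''⟩
  · rintro ⟨P, Q, h⟩
    have hd : ∀ {A P : Matrix (Fin (d + 1)) (Fin (d + 1)) K} {x : ℕ → K}, IsUnit P →
        A * P = P * diagonal (fun i : Fin (d + 1) => x i) → (P⁻¹ * A * P).IsDiag := by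
      intro A P x hP hA
      rw [Matrix.mul_assoc, hA, Matrix.nonsing_inv_mul_cancel_left _ _
        ((Matrix.isUnit_iff_isUnit_det P).1 hP)]
      exact isDiag_diagonal _
    exact ⟨⟨Q, h.right.isUnit, h.right.tridiagonal, hd h.right.isUnit h.right.mul_eq⟩,
      ⟨P, h.left.isUnit, h.left.tridiagonal, hd h.left.isUnit h.left.mul_eq⟩⟩

end LeonardPair

-- The split basis of a bidiagonal pair

section Bidiagonal

variable {K : Type*} [Field K] {d : ℕ} {θ θs φ : ℕ → K}
  {P Q : Matrix (Fin (d + 1)) (Fin (d + 1)) K}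

theorem HasSwitchingEntries.congr {φ' ϕ : ℕ → K} {q : AlgebraicClosure K}
    {M : Matrix (Fin (d + 1)) (Fin (d + 1)) K} (h : ∀ i, 1 ≤ i → i ≤ d → φ i = φ' i)
    (hM : HasSwitchingEntries d θs φ ϕ q M) : HasSwitchingEntries d θs φ' ϕ q M :=
  ⟨hM.1, fun i j hij => by
    rw [hM.2 i j hij, prodUp_congr h (show i.val ≤ d by omega)]⟩

theorem HasInverseSwitchingEntries.congr {φ' ϕ : ℕ → K} {q : AlgebraicClosure K}
    {M : Matrix (Fin (d + 1)) (Fin (d + 1)) K} (h : ∀ i, 1 ≤ i → i ≤ d → φ i = φ' i)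
    (hM : HasInverseSwitchingEntries d θs φ ϕ q M) :
    HasInverseSwitchingEntries d θs φ' ϕ q M :=
  ⟨hM.1, fun i j hij => by
    rw [hM.2 i j hij, prodUp_congr h (show j.val ≤ d by omega)]⟩

/-- For a bidiagonal pair the split basis is a multiple of the standard one. -/
theorem IsSystem.tauColumns_bidiagonal
    (h : IsSystem (lowerBidiagonal d θ) (upperBidiagonal d θs φ) θ θs P Q) :
    ∃ c : K, c ≠ 0 ∧ tauColumns (lowerBidiagonal d θ) θ (Q.col 0) = c • 1 := by
  obtain ⟨hWu, hLW, -, -⟩ := h.splitSequence_spec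
  have hW0 := tauColumns_zero (lowerBidiagonal d θ) θ (Q.col 0)
  set W := tauColumns (lowerBidiagonal d θ) θ (Q.col 0)
  -- `Q` is upper triangular, so its first column is a multiple of the first standard vector;
  -- applying `A - θ_j` then walks through the standard basis with the same multiple.
  have hQt : UpperBand 0 Qᵀ := by
    have h1 := UpperBand.of_mul_eq_mul_diagonal h.injOn_dual
      (upperBand_transpose_upperBidiagonal θs φ) (fun i => by simp [upperBidiagonal])
      h.transpose.right.mul_eq
    have h2 := h1.inv h.transpose.right.isUnit
    rwa [← transpose_nonsing_inv, Matrix.nonsing_inv_nonsing_inv Q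
      ((Matrix.isUnit_iff_isUnit_det Q).1 h.right.isUnit)] at h2
  have key : ∀ m : ℕ, ∀ i j : Fin (d + 1), j.val = m → W i j = if i = j then W 0 0 else 0 := by
    intro m
    induction m with
    | zero =>
      intro i j hj
      obtain rfl : j = 0 := Fin.ext hj
      split_ifs with hi
      · rw [hi]
      · rw [hW0]
        exact hQt 0 i (by have : i.val ≠ 0 := fun e => hi (Fin.ext e)
                          simp; omega)
    | succ m ih =>
      intro i k hk
      set j : Fin (d + 1) := ⟨m, by omega⟩ with hj
      have h1 := mul_lowerBidiagonal_of_succ W θ i j k hk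
      rw [← hLW, Matrix.mul_apply, Finset.sum_eq_single j, ih j j rfl, if_pos rfl,
        ih i j rfl] at h1
      · have hkj : k.val = j.val + 1 := hk
        by_cases hij : i = j
        · have hik : i ≠ k := fun e => by rw [← hij, e] at hkj; omega
          rw [if_pos hij] at h1
          rw [if_neg hik]
          simp only [lowerBidiagonal, of_apply, if_pos hij] at h1
          rw [hij] at h1 ⊢
          linear_combination -h1
        · rw [if_neg hij] at h1
          by_cases hik : i = k
          · have hkj' : ¬ k = j := hik ▸ hij
            rw [if_pos hik]
            simp only [lowerBidiagonal, of_apply, hik, if_neg hkj', hkj, if_true] at h1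
            rw [hik]
            linear_combination -h1
          · have : ¬ i.val = j.val + 1 := fun e => hik (Fin.ext (e.trans hkj.symm))
            rw [if_neg hik]
            simp only [lowerBidiagonal, of_apply, if_neg hij, if_neg this] at h1
            linear_combination -h1
      · intro l _ hl
        rw [ih l j rfl, if_neg hl, mul_zero]
      · simp
  have hWeq : W = W 0 0 • 1 := by
    ext i j
    rw [key _ i j rfl, Matrix.smul_apply, one_apply, smul_eq_mul, mul_ite, mul_one, mul_zero]
  refine ⟨W 0 0, fun h0 => ?_, hWeq⟩
  rw [h0, zero_smul] at hWeq
  rw [hWeq] at hWu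
  exact not_isUnit_zero hWu

theorem IsSystem.splitSequence_bidiagonal
    (h : IsSystem (lowerBidiagonal d θ) (upperBidiagonal d θs φ) θ θs P Q) {i : ℕ} (h1 : 1 ≤ i)
    (hi : i ≤ d) :
    splitSequence d (lowerBidiagonal d θ) (upperBidiagonal d θs φ) θ θs i = φ i := by
  obtain ⟨c, hc, hW⟩ := h.tauColumns_bidiagonal
  obtain ⟨-, -, hBW, -⟩ := h.splitSequence_spec
  rw [hW, mul_smul_comm, mul_one, smul_mul_assoc, one_mul] at hBW
  have h2 := congrFun (congrFun (smul_right_injective _ hc hBW) ⟨i - 1, by omega⟩) ⟨i, by omega⟩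
  have h3 : i - 1 ≠ i := by omega
  have h4 : i = i - 1 + 1 := by omega
  simp only [upperBidiagonal, of_apply, Fin.mk.injEq, if_neg h3, if_pos h4] at h2
  exact h2.symm

end Bidiagonal

-- Transfer to an abstract matrix algebra and its simple module

section Transfer

variable {K 𝒜 V : Type*} [Field K] [Ring 𝒜] [Algebra K 𝒜] {d : ℕ}

/-- The image of system data under an algebra isomorphism. -/
def SystemData.map {ℬ : Type*} (Φ : SystemData K 𝒜) (e : 𝒜 → ℬ) : SystemData K ℬ where
  A := e Φ.A
  As := e Φ.As
  θ := Φ.θ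
  θs := Φ.θs

variable (e : 𝒜 ≃ₐ[K] Matrix (Fin (d + 1)) (Fin (d + 1)) K) (Φ : SystemData K 𝒜)

theorem map_aeval_equiv (X : 𝒜) (p : K[X]) : e (aeval X p) = aeval (e X) p :=
  (aeval_algHom_apply e X p).symm

theorem SystemData.map_E (i : ℕ) : e (Φ.E d i) = (Φ.map e).E d i := map_aeval_equiv e _ _

theorem SystemData.map_Es (i : ℕ) : e (Φ.Es d i) = (Φ.map e).Es d i := map_aeval_equiv e _ _

theorem SystemData.firstSplit_map :
    (Φ.map e).firstSplit d AlgEquiv.refl = Φ.firstSplit d e := by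
  funext i
  simp only [SystemData.firstSplit, map_mul, map_aeval_equiv, SystemData.map_Es]
  rfl

theorem SystemData.secondSplit_map :
    (Φ.map e).secondSplit d AlgEquiv.refl = Φ.secondSplit d e := by
  funext i
  simp only [SystemData.secondSplit, map_mul, map_aeval_equiv, SystemData.map_Es]
  rfl

theorem SystemData.switching_map :
    (Φ.map e).switching d AlgEquiv.refl = e (Φ.switching d e) := by
  simp only [SystemData.switching, SystemData.firstSplit_map, SystemData.secondSplit_map,
    map_sum, map_smul, SystemData.map_E]

theorem SystemData.IsLeonardSystem.map {Φ : SystemData K 𝒜} (h : Φ.IsLeonardSystem d) :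
    (Φ.map e).IsLeonardSystem d := by
  refine ⟨⟨h.ordering.1, ?_⟩, ⟨h.ordering_dual.1, ?_⟩, ?_, ?_, ?_, ?_⟩
  · exact (AlgEquiv.spectrum_eq e Φ.A).trans h.ordering.2
  · exact (AlgEquiv.spectrum_eq e Φ.As).trans h.ordering_dual.2
  · intro i j hi hj hij
    have := congrArg e (h.dual_zero i j hi hj hij)
    rwa [map_mul, map_mul, SystemData.map_E, SystemData.map_E, map_zero] at this
  · intro i j hi hj hij h0
    refine h.dual_ne_zero i j hi hj hij (e.injective ?_)
    rwa [map_mul, map_mul, SystemData.map_E, SystemData.map_E, map_zero]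
  · intro i j hi hj hij
    have := congrArg e (h.zero i j hi hj hij)
    rwa [map_mul, map_mul, SystemData.map_Es, SystemData.map_Es, map_zero] at this
  · intro i j hi hj hij h0
    refine h.ne_zero i j hi hj hij (e.injective ?_)
    rwa [map_mul, map_mul, SystemData.map_Es, SystemData.map_Es, map_zero]

/-- A simple module over a matrix algebra is the module of column vectors; a nonzero vector fixed
by a rank one idempotent may be matched with the column of the idempotent. -/
theorem exists_columnEquiv [AddCommGroup V] [Module K V] [Module 𝒜 V] [IsScalarTower K 𝒜 V]
    [IsSimpleModule 𝒜 V] {x f : Fin (d + 1) → K} {v : V} (hv : v ≠ 0)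
    (hfix : e.symm (vecMulVec x f) • v = v) :
    ∃ ι : (Fin (d + 1) → K) ≃ₗ[K] V, ι x = v ∧
      ∀ (X : 𝒜) (y : Fin (d + 1) → K), ι (e X *ᵥ y) = X • ι y := by
  -- The matrices `y fᵀ` form a minimal left ideal, a copy of the column vectors; acting on `v`
  -- carries it into `V`.
  let ι : (Fin (d + 1) → K) →ₗ[K] V :=
    { toFun := fun y => e.symm (vecMulVec y f) • v
      map_add' := fun y z => by rw [add_vecMulVec, map_add, add_smul]
      map_smul' := fun k y => by
        rw [smul_vecMulVec, map_smul, smul_assoc, RingHom.id_apply] }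
  have hι : ∀ (X : 𝒜) (y : Fin (d + 1) → K), ι (e X *ᵥ y) = X • ι y := by
    intro X y
    change e.symm (vecMulVec (e X *ᵥ y) f) • v = X • e.symm (vecMulVec y f) • v
    rw [← mul_vecMulVec, map_mul, AlgEquiv.symm_apply_apply, mul_smul]
  have hx : ι x = v := hfix
  have hinj : Function.Injective ι := by
    rw [injective_iff_map_eq_zero]
    intro y hy
    by_contra hne
    obtain ⟨i, hi⟩ := Function.ne_iff.1 hne
    -- The chosen rank one matrix sends `y` to `x`, so a nonzero `y` in the kernel would force `v =
    -- ι x = 0`.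
    have h1 := hι (e.symm (vecMulVec x (Pi.single i (y i)⁻¹))) y
    rw [hy, smul_zero, AlgEquiv.apply_symm_apply, vecMulVec_mulVec] at h1
    have h2 : Pi.single i (y i)⁻¹ ⬝ᵥ y = 1 := by
      rw [single_dotProduct, inv_mul_cancel₀ hi]
    rw [h2] at h1
    simp only [MulOpposite.op_one, one_smul] at h1
    exact hv (hx.symm.trans h1)
  have hsurj : Function.Surjective ι := by
    let N : Submodule 𝒜 V :=
      { carrier := Set.range ι
        add_mem' := by
          rintro _ _ ⟨y, rfl⟩ ⟨z, rfl⟩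
          exact ⟨y + z, map_add ι y z⟩
        zero_mem' := ⟨0, map_zero ι⟩
        smul_mem' := by
          rintro X _ ⟨y, rfl⟩
          exact ⟨e X *ᵥ y, hι X y⟩ }
    have hN : N = ⊤ := by
      refine (IsSimpleOrder.eq_bot_or_eq_top N).resolve_left fun hbot => hv ?_
      have hvN : v ∈ N := ⟨x, hx⟩
      rwa [hbot, Submodule.mem_bot] at hvN
    intro w
    have hw : w ∈ N := hN ▸ Submodule.mem_top
    exact hw
  exact ⟨LinearEquiv.ofBijective ι ⟨hinj, hsurj⟩, hx, hι⟩

end Transfer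

end Leonard

-- Assembly of the theorem

theorem theorem11p6 {K : Type*} [Field K] (d : ℕ) :
    -- a Leonard system in `𝒜`, with respect to the basis `τ_i(A) v^*_0` of `V`
    (∀ {𝒜 : Type*} [Ring 𝒜] [Algebra K 𝒜]
        (e : 𝒜 ≃ₐ[K] Matrix (Fin (d + 1)) (Fin (d + 1)) K)
        {V : Type*} [AddCommGroup V] [Module K V] [Module 𝒜 V] [IsScalarTower K 𝒜 V]
        [IsSimpleModule 𝒜 V]
        (Φ : Leonard.SystemData K 𝒜), Φ.IsLeonardSystem d →
        ∀ v : V, v ≠ 0 → (∃ w : V, v = Φ.Es d 0 • w) →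
          IsUnit (Φ.switching d e) ∧
          ∃ b : Module.Basis (Fin (d + 1)) K V,
            (∀ i, b i = (Polynomial.aeval Φ.A (Leonard.tau Φ.θ i.val)) • v) ∧
            (∃ q, Φ.IsBase d q) ∧
            ∀ q, Φ.IsBase d q →
              Leonard.HasSwitchingEntries d Φ.θs (Φ.firstSplit d e) (Φ.secondSplit d e) q
                (Leonard.repMatrix b (Φ.switching d e)) ∧
              Leonard.HasInverseSwitchingEntries d Φ.θs (Φ.firstSplit d e)
                (Φ.secondSplit d e) q
                (Leonard.repMatrix b (Ring.inverse (Φ.switching d e)))) ∧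
    -- a Leonard pair of bidiagonal matrices
    (∀ θ θs φ : ℕ → K,
        Set.InjOn θ (Set.Iic d) → Set.InjOn θs (Set.Iic d) →
        (∀ i, 1 ≤ i → i ≤ d → φ i ≠ 0) →
        (Leonard.IsLeonardPair d (Matrix.toLin' (Leonard.lowerBidiagonal d θ))
            (Matrix.toLin' (Leonard.upperBidiagonal d θs φ)) ↔
          (Leonard.bidiagonalData d θ θs φ).IsLeonardSystem d) ∧
        (Leonard.IsLeonardPair d (Matrix.toLin' (Leonard.lowerBidiagonal d θ))
            (Matrix.toLin' (Leonard.upperBidiagonal d θs φ)) →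
          (∀ i, 1 ≤ i → i ≤ d →
            (Leonard.bidiagonalData d θ θs φ).firstSplit d AlgEquiv.refl i = φ i) ∧
          IsUnit ((Leonard.bidiagonalData d θ θs φ).switching d AlgEquiv.refl) ∧
          (∃ q, (Leonard.bidiagonalData d θ θs φ).IsBase d q) ∧
          ∀ q, (Leonard.bidiagonalData d θ θs φ).IsBase d q →
            Leonard.HasSwitchingEntries d θs φ
              ((Leonard.bidiagonalData d θ θs φ).secondSplit d AlgEquiv.refl) q
              ((Leonard.bidiagonalData d θ θs φ).switching d AlgEquiv.refl) ∧
            Leonard.HasInverseSwitchingEntries d θs φ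
              ((Leonard.bidiagonalData d θ θs φ).secondSplit d AlgEquiv.refl) q
              ((Leonard.bidiagonalData d θ θs φ).switching d AlgEquiv.refl)⁻¹)) := by

  refine ⟨?_, ?_⟩
  · intro 𝒜 _ _ e V _ _ _ _ _ Φ hΦ v hv hvw
    obtain ⟨P, Q, h⟩ := (Leonard.isLeonardSystem_iff _).1 (hΦ.map e)
    have hEs := Leonard.primitiveIdempotent_eq h.injOn_dual h.right.isUnit h.right.mul_eq 0
    have hQ := Leonard.inv_mul_of_isUnit h.right.isUnit
    have hEs' : Φ.Es d 0 = e.symm (Matrix.vecMulVec (Q.col 0) (Q⁻¹.row 0)) := by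
      rw [← hEs, AlgEquiv.eq_symm_apply, Leonard.SystemData.map_Es]
      rfl
    have hidem : Φ.Es d 0 * Φ.Es d 0 = Φ.Es d 0 := by
      rw [hEs', ← map_mul, Matrix.vecMulVec_mul_vecMulVec]
      have : Q⁻¹.row 0 ⬝ᵥ Q.col 0 = 1 := by
        have h1 := congrFun (congrFun hQ 0) 0
        rwa [Matrix.mul_apply, Matrix.one_apply_eq] at h1
      rw [this, one_smul]
    -- Lying in the image of an idempotent means being fixed by it, as `exists_columnEquiv`
    -- requires.
    have hfix : Φ.Es d 0 • v = v := by
      obtain ⟨w, rfl⟩ := hvw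
      rw [← mul_smul, hidem]
    rw [hEs'] at hfix
    obtain ⟨ι, hιx, hι⟩ := Leonard.exists_columnEquiv e hv hfix
    obtain ⟨hWu, -, -, -⟩ := h.splitSequence_spec
    obtain ⟨hSu, hent⟩ := h.switching
    rw [Leonard.SystemData.switching_map] at hSu hent
    simp only [Leonard.SystemData.firstSplit_map, Leonard.SystemData.secondSplit_map] at hent
    have hSu' : IsUnit (Φ.switching d e) := by
      have := hSu.map e.symm
      rwa [AlgEquiv.symm_apply_apply] at this
    have hinv : (e (Φ.switching d e))⁻¹ = e (Ring.inverse (Φ.switching d e)) := by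
      refine Matrix.inv_eq_right_inv ?_
      rw [← map_mul, Ring.mul_inverse_cancel _ hSu', map_one]
    rw [hinv] at hent
    set W := Leonard.tauColumns (Φ.map e).A (Φ.map e).θ (Q.col 0) with hW
    have hrep : ∀ X : 𝒜, Leonard.repMatrix ((Leonard.columnBasis W hWu).map ι) X =
        W⁻¹ * e X * W := by
      intro X
      ext i j
      rw [Leonard.repMatrix, Matrix.of_apply, Module.Basis.map_apply, ← hι,
        Module.Basis.map_repr, LinearEquiv.trans_apply, LinearEquiv.symm_apply_apply,
        Leonard.columnBasis_repr, Leonard.columnBasis_apply, Matrix.mulVec_mulVec]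
      rfl
    refine ⟨hSu', (Leonard.columnBasis W hWu).map ι, fun i => ?_, h.exists_isBase, ?_⟩
    · rw [Module.Basis.map_apply, Leonard.columnBasis_apply, ← hιx, ← hι,
        Leonard.map_aeval_equiv]
      rfl
    · intro q hq
      rw [hrep, hrep]
      exact hent q hq
  · intro θ θs φ hθ hθs hφ
    have hiff := Leonard.isLeonardPair_bidiagonal_iff hθ hθs hφ
    refine ⟨hiff, fun hLP => ?_⟩
    obtain ⟨P, Q, h⟩ := (Leonard.isLeonardSystem_iff _).1 (hiff.1 hLP)
    have hsplit : ∀ i, 1 ≤ i → i ≤ d →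
        (Leonard.bidiagonalData d θ θs φ).firstSplit d AlgEquiv.refl i = φ i :=
      fun i h1 hi => Leonard.IsSystem.splitSequence_bidiagonal h h1 hi
    obtain ⟨hSu, hent⟩ := h.switching
    obtain ⟨c, hc, hW⟩ := Leonard.IsSystem.tauColumns_bidiagonal h
    -- The split basis is a scalar multiple of the standard one, so the matrices already stand in
    -- the required basis.
    have hconj : ∀ X : Matrix (Fin (d + 1)) (Fin (d + 1)) K,
        (Leonard.tauColumns (Leonard.bidiagonalData d θ θs φ).A
          (Leonard.bidiagonalData d θ θs φ).θ (Q.col 0))⁻¹ * X *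
        Leonard.tauColumns (Leonard.bidiagonalData d θ θs φ).A
          (Leonard.bidiagonalData d θ θs φ).θ (Q.col 0) = X := by
      intro X
      have hW' : Leonard.tauColumns (Leonard.bidiagonalData d θ θs φ).A
          (Leonard.bidiagonalData d θ θs φ).θ (Q.col 0) = c • 1 := hW
      have hWi : (c • 1 : Matrix (Fin (d + 1)) (Fin (d + 1)) K)⁻¹ = c⁻¹ • 1 := by
        refine Matrix.inv_eq_right_inv ?_
        rw [smul_mul_smul_comm, mul_inv_cancel₀ hc, one_mul, one_smul]
      rw [hW', hWi, smul_mul_assoc, one_mul, smul_mul_smul_comm, inv_mul_cancel₀ hc, mul_one,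
        one_smul]
    refine ⟨hsplit, hSu, h.exists_isBase, fun q hq => ?_⟩
    have h1 := hent q hq
    rw [hconj, hconj] at h1
    exact ⟨h1.1.congr hsplit, h1.2.congr hsplit⟩
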